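/- Let $R$ be a commutative ring and let $G=\operatorname{Spec} A$ be an affine $R$-monoid scheme (so $A$ is a commutative $R$-bialgebra), with functor of points $G(S)=\operatorname{Hom}_{R\text{-alg}}(A,S)$ on commutative $R$-algebras $S$. Assume that $A$ is a projective $R$-module. A functor of $\mathcal R$-modules is a covariant functor $\mathbb M$ from commutative $R$-algebras to abelian groups such that each $\mathbb M(S)$ is an $S$-module, functorially in $S$; sequences of such functors are exact if they are exact at every $S$. It is a dual functor if $\mathbb M\cong\mathbb N^*$ for some functor of $\mathcal R$-modules $\mathbb N$, where $\mathbb N^*(S)=\operatorname{Hom}_{\mathcal S}(\mathbb N_{|S},\mathcal S)$, $\mathbb N_{|S}$ is the restriction of $\mathbb N$ to commutative $S$-algebras and $\mathcal S(T)=T$; it is quasi-coherent if $\mathbb M\cong\mathcal M$ with $\mathcal M(S)=M\otimes_R S$ for an $R$-module $M$, and coherent if moreover $M$ can be chosen finitely generated. A functor of left (right) $G$-modules is a functor of $\mathcal R$-modules $\mathbb M$ with a functorial $S$-linear left (right) action of $G(S)$ on $\mathbb M(S)$; its invariants are the functor $\mathbb M^G(S)=\{m\in\mathbb M(S): g\cdot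 m=m \text{ for all } S\to T \text{ and } g\in G(T)\}$ (with $m\cdot g=m$ for right actions). The monoid scheme $G$ is invariant exact if, both for left and for right $G$-modules, for every short exact sequence $0\to\mathbb M_1\to\mathbb M_2\to\mathbb M_3\to0$ of dual functors of $G$-modules (with $G$-equivariant morphisms) the sequence $0\to\mathbb M_1^G\to\mathbb M_2^G\to\mathbb M_3^G\to0$ is exact. A rational left (right) $G$-module is an $R$-module $M$ with a coassociative (for right modules: with respect to the opposite comultiplication of $A$) and counital coaction $\mu\colon M\to M\otimes_R A$; $M^G=\{m:\mu(m)=m\otimes1\}$, and sequences of rational modules are exact if they are exact as sequences of $R$-modules. Then the following are equivalent: 1. $G$ is invariant exact; 2. taking invariants is exact (it carries short exact sequences of functors to short exact sequences of functors) on coherent left $G$-modules and on coherent right $G$-modules; 3. taking invariants is exact, in the same sense, on quasi-coherent left $G$-modules and on quasi-coherent right $G$-modules; 4. taking invariants is exact (it carries short exact sequences to short exact sequences) on the rational left $G$-modules that are finitely generated over $R$ and on the rational right $G$-modules that are finitely generated over $R$; 5. taking invariants is exact on rational left $G$-modules and on rational right $G$-modules. -/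

import Mathlib

open scoped TensorProduct
open WithConv

universe u v w

/-- A functor of `𝓡`-modules: a covariant functor `𝕄` from commutative `R`-algebras (in `Type u`) to
abelian groups, such that every `𝕄(S)` is an `S`-module, compatibly with the transition maps. -/
structure ModFunctor (R : Type u) [CommRing R] where
  obj : (S : Type u) → [CommRing S] → [Algebra R S] → Type v
  [addCommGroup : (S : Type u) → [CommRing S] → [Algebra R S] → AddCommGroup (obj S)]
  [module : (S : Type u) → [CommRing S] → [Algebra R S] → Module S (obj S)]
  map : {S T : Type u} → [CommRing S] → [Algebra R S] → [CommRing T] → [Algebra R T] →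
    (S →ₐ[R] T) → obj S →+ obj T
  map_smul : ∀ {S T : Type u} [CommRing S] [Algebra R S] [CommRing T] [Algebra R T]
    (f : S →ₐ[R] T) (s : S) (m : obj S), map f (s • m) = f s • map f m
  map_id : ∀ {S : Type u} [CommRing S] [Algebra R S] (m : obj S), map (AlgHom.id R S) m = m
  map_comp : ∀ {S T U : Type u} [CommRing S] [Algebra R S] [CommRing T] [Algebra R T]
    [CommRing U] [Algebra R U] (g : T →ₐ[R] U) (f : S →ₐ[R] T) (m : obj S),
    map (g.comp f) m = map g (map f m)

namespace ModFunctor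

attribute [instance] ModFunctor.addCommGroup ModFunctor.module

variable {R : Type u} [CommRing R]

/-- Morphisms of functors of `𝓡`-modules. -/
structure Hom (M : ModFunctor.{u, v} R) (N : ModFunctor.{u, w} R) where
  app : (S : Type u) → [CommRing S] → [Algebra R S] → M.obj S →ₗ[S] N.obj S
  naturality : ∀ {S T : Type u} [CommRing S] [Algebra R S] [CommRing T] [Algebra R T]
    (f : S →ₐ[R] T) (m : M.obj S), app T (M.map f m) = N.map f (app S m)

/-- Isomorphisms of functors of `𝓡`-modules. -/
structure Iso (M : ModFunctor.{u, v} R) (N : ModFunctor.{u, w} R) where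
  app : (S : Type u) → [CommRing S] → [Algebra R S] → M.obj S ≃ₗ[S] N.obj S
  naturality : ∀ {S T : Type u} [CommRing S] [Algebra R S] [CommRing T] [Algebra R T]
    (f : S →ₐ[R] T) (m : M.obj S), app T (M.map f m) = N.map f (app S m)

/-- Exactness of `0 → M₁ → M₂ → M₃ → 0` in the category of functors of `𝓡`-modules
(kernels and cokernels there are computed at each `R`-algebra `S`). -/
def IsShortExact {M₁ M₂ M₃ : ModFunctor.{u, v} R} (f : Hom M₁ M₂) (g : Hom M₂ M₃) : Prop :=
  ∀ (S : Type u) [CommRing S] [Algebra R S],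
    Function.Injective (f.app S) ∧ Function.Exact (f.app S) (g.app S) ∧
      Function.Surjective (g.app S)

/-- The elements of `ℍom_𝓡(M, N)(S) = Hom_𝓢(M_{|S}, N_{|S})`: natural families of `T`-linear maps
`M(T) → N(T)`, where `T` runs over the commutative `S`-algebras (given by the morphisms of
`R`-algebras `S → T`). -/
@[ext]
structure HomOver (M : ModFunctor.{u, v} R) (N : ModFunctor.{u, w} R)
    (S : Type u) [CommRing S] [Algebra R S] where
  app : (T : Type u) → [CommRing T] → [Algebra R T] → (S →ₐ[R] T) → M.obj T →ₗ[T] N.obj T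
  naturality : ∀ {T U : Type u} [CommRing T] [Algebra R T] [CommRing U] [Algebra R U]
    (h : S →ₐ[R] T) (f : T →ₐ[R] U) (m : M.obj T),
    app U (f.comp h) (M.map f m) = N.map f (app T h m)

namespace HomOver

variable {M : ModFunctor.{u, v} R} {N : ModFunctor.{u, w} R} {S : Type u} [CommRing S] [Algebra R S]

instance : Zero (HomOver M N S) := ⟨⟨fun _ _ _ _ => 0, by intros; simp⟩⟩

instance : Add (HomOver M N S) :=
  ⟨fun φ ψ => ⟨fun T _ _ h => φ.app T h + ψ.app T h, by
    intros; simp [φ.naturality, ψ.naturality]⟩⟩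

instance : Neg (HomOver M N S) :=
  ⟨fun φ => ⟨fun T _ _ h => -φ.app T h, by intros; simp [φ.naturality]⟩⟩

instance : AddCommGroup (HomOver M N S) where
  nsmul := nsmulRec
  zsmul := zsmulRec
  add_assoc φ ψ χ := by
    apply HomOver.ext; funext T _ _ h; exact add_assoc (φ.app T h) (ψ.app T h) (χ.app T h)
  zero_add φ := by apply HomOver.ext; funext T _ _ h; exact zero_add (φ.app T h)
  add_zero φ := by apply HomOver.ext; funext T _ _ h; exact add_zero (φ.app T h)
  add_comm φ ψ := by
    apply HomOver.ext; funext T _ _ h; exact add_comm (φ.app T h) (ψ.app T h)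
  neg_add_cancel φ := by
    apply HomOver.ext; funext T _ _ h; exact neg_add_cancel (φ.app T h)

/-- `S` acts on a family through the structure morphism `S → T` of each `S`-algebra `T`. -/
instance : Module S (HomOver M N S) where
  smul s φ := ⟨fun T _ _ h => h s • φ.app T h, by
    intros; simp [φ.naturality, N.map_smul]⟩
  one_smul φ := by
    apply HomOver.ext; funext T _ _ h
    change h 1 • φ.app T h = φ.app T h
    rw [map_one, one_smul]
  mul_smul s t φ := by
    apply HomOver.ext; funext T _ _ h
    change h (s * t) • φ.app T h = h s • h t • φ.app T h
    rw [map_mul, mul_smul]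
  smul_zero s := by
    apply HomOver.ext; funext T _ _ h
    exact smul_zero (h s)
  smul_add s φ ψ := by
    apply HomOver.ext; funext T _ _ h
    exact smul_add (h s) (φ.app T h) (ψ.app T h)
  add_smul s t φ := by
    apply HomOver.ext; funext T _ _ h
    change h (s + t) • φ.app T h = h s • φ.app T h + h t • φ.app T h
    rw [map_add, add_smul]
  zero_smul φ := by
    apply HomOver.ext; funext T _ _ h
    change h 0 • φ.app T h = 0
    rw [map_zero, zero_smul]

end HomOver

/-- The functor of `𝓡`-modules `ℍom_𝓡(M, N)`. -/
def homFunctor (M : ModFunctor.{u, v} R) (N : ModFunctor.{u, w} R) :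
    ModFunctor.{u, max (u + 1) v w} R where
  obj S _ _ := HomOver M N S
  addCommGroup _ _ _ := inferInstance
  module _ _ _ := inferInstance
  map k :=
    { toFun := fun φ => ⟨fun T _ _ h => φ.app T (h.comp k), fun h f m => φ.naturality (h.comp k) f m⟩
      map_zero' := rfl
      map_add' := fun _ _ => rfl }
  map_smul _ _ _ := rfl
  map_id _ := rfl
  map_comp _ _ _ := rfl

/-- The functor of rings `𝓡`, `𝓡(S) = S`, as a functor of `𝓡`-modules. -/
def ringFunctor (R : Type u) [CommRing R] : ModFunctor.{u, u} R where
  obj S _ _ := S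
  addCommGroup _ _ _ := inferInstance
  module _ _ _ := inferInstance
  map f := (f : _ →+* _).toAddMonoidHom
  map_smul f s m := map_mul f s m
  map_id _ := rfl
  map_comp _ _ _ := rfl

/-- The dual `M* = ℍom_𝓡(M, 𝓡)`. -/
def dual (M : ModFunctor.{u, v} R) : ModFunctor.{u, max (u + 1) v} R :=
  homFunctor M (ringFunctor R)

/-- The quasi-coherent module `𝓜` of an `R`-module `M`: `𝓜(S) = S ⊗_R M`. -/
def quasiCoherent (M : Type u) [AddCommGroup M] [Module R M] : ModFunctor.{u, u} R where
  obj S _ _ := S ⊗[R] M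
  addCommGroup _ _ _ := inferInstance
  module _ _ _ := inferInstance
  map f := (LinearMap.rTensor M f.toLinearMap).toAddMonoidHom
  map_smul f s m := by
    induction m using TensorProduct.induction_on with
    | zero => simp
    | tmul a m => simp [TensorProduct.smul_tmul']
    | add x y hx hy =>
      rw [smul_add, map_add, hx, hy, map_add, smul_add]
  map_id m := LinearMap.rTensor_id_apply M _ m
  map_comp g f m := LinearMap.rTensor_comp_apply M g.toLinearMap f.toLinearMap m

/-- `M` is a dual functor, i.e. `M ≅ N*` for some functor of `𝓡`-modules `N`. The values of `N*` are
sets of natural families indexed by all algebras in `Type u`, so they live in `Type (u + 1)`. -/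
def IsDual (M : ModFunctor.{u, u + 1} R) : Prop :=
  ∃ N : ModFunctor.{u, u + 1} R, Nonempty (Iso M (dual N))

/-- `M` is (isomorphic to) a quasi-coherent module. -/
def IsQuasiCoherent (M : ModFunctor.{u, u + 1} R) : Prop :=
  ∃ (E : Type u) (_ : AddCommGroup E) (_ : Module R E), Nonempty (Iso M (quasiCoherent (R := R) E))

/-- `M` is (isomorphic to) a coherent module: the quasi-coherent module of a finitely generated
`R`-module. -/
def IsCoherent (M : ModFunctor.{u, u + 1} R) : Prop :=
  ∃ (E : Type u) (_ : AddCommGroup E) (_ : Module R E), Module.Finite R E ∧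
    Nonempty (Iso M (quasiCoherent (R := R) E))

end ModFunctor

/-- Left or right actions. -/
inductive Side
  | left
  | right

/-- The order in which a product acts: `g * h` for left actions, `h * g` for right actions. -/
def Side.mul {P : Type*} [Mul P] : Side → P → P → P
  | .left, g, h => g * h
  | .right, g, h => h * g

/-- The comultiplication of `A` for left actions, the opposite one for right actions. -/
def Side.comul (R A : Type*) [CommRing R] [CommRing A] [Bialgebra R A] :
    Side → A →ₗ[R] A ⊗[R] A
  | .left => Coalgebra.comul
  | .right => (TensorProduct.comm R A A).toLinearMap ∘ₗ Coalgebra.comul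

/-- The functor of points of `G = Spec A`: `G(S) = Hom_{R-alg}(A, S)`; for a commutative bialgebra
`A` it is a monoid under convolution, `(g * h)(a) = ∑ g(a₁) h(a₂)`. -/
abbrev Points (R A S : Type u) [CommRing R] [CommRing A] [Bialgebra R A] [CommRing S]
    [Algebra R S] : Type u :=
  WithConv (A →ₐ[R] S)

/-- The map `G(S) → G(T)` induced by `f : S → T`. -/
def Points.map {R A S T : Type u} [CommRing R] [CommRing A] [Bialgebra R A] [CommRing S]
    [Algebra R S] [CommRing T] [Algebra R T] (f : S →ₐ[R] T) (g : Points R A S) : Points R A T :=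
  toConv (f.comp g.ofConv)

/-- A functor of left (`σ = left`) or right (`σ = right`) `G`-modules, `G = Spec A`: a functor of
`𝓡`-modules `𝕄` with a functorial `S`-linear action of the monoid `G(S)` on `𝕄(S)`, that is (for
left modules) a morphism of functors of monoids `G → 𝔼nd_𝓡(𝕄)`. -/
structure GModFunctor (R A : Type u) [CommRing R] [CommRing A] [Bialgebra R A] (σ : Side)
    extends ModFunctor.{u, v} R where
  act : {S : Type u} → [CommRing S] → [Algebra R S] → Points R A S → obj S →ₗ[S] obj S
  act_one : ∀ {S : Type u} [CommRing S] [Algebra R S] (m : obj S), act (1 : Points R A S) m = m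
  act_mul : ∀ {S : Type u} [CommRing S] [Algebra R S] (g h : Points R A S) (m : obj S),
    act (σ.mul g h) m = act g (act h m)
  map_act : ∀ {S T : Type u} [CommRing S] [Algebra R S] [CommRing T] [Algebra R T]
    (f : S →ₐ[R] T) (g : Points R A S) (m : obj S),
    map f (act g m) = act (Points.map f g) (map f m)

namespace GModFunctor

variable {R A : Type u} [CommRing R] [CommRing A] [Bialgebra R A] {σ : Side}

/-- Morphisms of functors of `G`-modules. -/
structure Hom (M N : GModFunctor.{u, v} R A σ) extends
    ModFunctor.Hom M.toModFunctor N.toModFunctor where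
  map_act : ∀ {S : Type u} [CommRing S] [Algebra R S] (g : Points R A S) (m : M.obj S),
    app S (M.act g m) = N.act g (app S m)

/-- `𝕄(S)^G`: the `m ∈ 𝕄(S)` with `g · m = m` in `𝕄(T)` for all `S → T` and all `g ∈ G(T)`. -/
def invariantsAt (M : GModFunctor.{u, v} R A σ) (S : Type u) [CommRing S] [Algebra R S] :
    Submodule S (M.obj S) where
  carrier := {m | ∀ (T : Type u) [CommRing T] [Algebra R T] (f : S →ₐ[R] T) (g : Points R A T),
    M.act g (M.map f m) = M.map f m}
  zero_mem' := by intro T _ _ f g; simp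
  add_mem' := by
    intro a b ha hb T _ _ f g
    rw [map_add, map_add, ha T f g, hb T f g]
  smul_mem' := by
    intro s m hm T _ _ f g
    rw [M.map_smul, LinearMap.map_smul, hm T f g]

/-- The functor of `𝓡`-modules `𝕄^G`, a subfunctor of `𝕄`. -/
def invariants (M : GModFunctor.{u, v} R A σ) : ModFunctor.{u, v} R where
  obj S _ _ := M.invariantsAt S
  addCommGroup _ _ _ := inferInstance
  module _ _ _ := inferInstance
  map f :=
    { toFun := fun m => ⟨M.map f m.1, by
        intro U _ _ k g
        rw [← M.map_comp]
        exact m.2 U (k.comp f) g⟩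
      map_zero' := Subtype.ext (map_zero (M.map f))
      map_add' := fun a b => Subtype.ext (map_add (M.map f) a.1 b.1) }
  map_smul f s m := Subtype.ext (M.map_smul f s m.1)
  map_id m := Subtype.ext (M.map_id m.1)
  map_comp g f m := Subtype.ext (M.map_comp g f m.1)

/-- The morphism `𝕄^G → ℕ^G` induced by a morphism `𝕄 → ℕ` of functors of `G`-modules. -/
def Hom.invariants {M N : GModFunctor.{u, v} R A σ} (φ : Hom M N) :
    ModFunctor.Hom M.invariants N.invariants where
  app S _ _ := (φ.app S).restrict (p := M.invariantsAt S) (q := N.invariantsAt S) (by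
    intro m hm T _ _ f g
    rw [← φ.naturality, ← φ.map_act, hm T f g])
  naturality f m := Subtype.ext (φ.naturality f m.1)

end GModFunctor

/-- Taking invariants preserves the short exact sequences (of functors of `𝓡`-modules) formed by
functors of left, resp. right, `G`-modules whose underlying functors of `𝓡`-modules satisfy `P`. -/
def InvariantsExactOn (R A : Type u) [CommRing R] [CommRing A] [Bialgebra R A] (σ : Side)
    (P : ModFunctor.{u, u + 1} R → Prop) : Prop :=
  ∀ (M₁ M₂ M₃ : GModFunctor.{u, u + 1} R A σ) (f : M₁.Hom M₂) (g : M₂.Hom M₃),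
    P M₁.toModFunctor → P M₂.toModFunctor → P M₃.toModFunctor →
    ModFunctor.IsShortExact f.toHom g.toHom →
    ModFunctor.IsShortExact f.invariants g.invariants

/-- `G = Spec A` is invariant exact: taking invariants is exact on the dual functors of left
`G`-modules and on the dual functors of right `G`-modules. -/
def IsInvariantExact (R A : Type u) [CommRing R] [CommRing A] [Bialgebra R A] : Prop :=
  InvariantsExactOn R A .left ModFunctor.IsDual ∧ InvariantsExactOn R A .right ModFunctor.IsDual

/-- A rational left (`σ = left`) or right (`σ = right`) `G`-module, `G = Spec A`: an `R`-module `M`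
with a coassociative and counital coaction `μ : M → M ⊗ A`; if `μ m = ∑ mₗ ⊗ aₗ` then `g ∈ G(S)` acts
by `g · m = ∑ aₗ(g) mₗ`. For right modules, coassociativity is with respect to the opposite
comultiplication of `A`. -/
structure RationalModule (R A : Type u) [CommRing R] [CommRing A] [Bialgebra R A] (σ : Side) where
  carrier : Type u
  [addCommGroup : AddCommGroup carrier]
  [module : Module R carrier]
  coact : carrier →ₗ[R] carrier ⊗[R] A
  coassoc : (TensorProduct.assoc R carrier A A).toLinearMap ∘ₗ coact.rTensor A ∘ₗ coact =
    (σ.comul R A).lTensor carrier ∘ₗ coact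
  counit_coact : (TensorProduct.rid R carrier).toLinearMap ∘ₗ
    (Coalgebra.counit (R := R) (A := A)).lTensor carrier ∘ₗ coact = LinearMap.id

namespace RationalModule

attribute [instance] RationalModule.addCommGroup RationalModule.module

variable {R A : Type u} [CommRing R] [CommRing A] [Bialgebra R A] {σ : Side}

/-- Morphisms of rational `G`-modules. -/
structure Hom (M N : RationalModule R A σ) where
  toLinearMap : M.carrier →ₗ[R] N.carrier
  map_coact : ∀ m, N.coact (toLinearMap m) = toLinearMap.rTensor A (M.coact m)

/-- `M^G = {m ∈ M : μ m = m ⊗ 1}`. -/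
def invariants (M : RationalModule R A σ) : Submodule R M.carrier :=
  LinearMap.eqLocus M.coact ((TensorProduct.mk R M.carrier A).flip 1)

/-- The map `M^G → N^G` induced by a morphism `M → N` of rational `G`-modules. -/
def Hom.invariants {M N : RationalModule R A σ} (φ : Hom M N) : M.invariants →ₗ[R] N.invariants :=
  φ.toLinearMap.restrict (by
    intro m hm
    have hm' : M.coact m = m ⊗ₜ[R] (1 : A) := hm
    change N.coact (φ.toLinearMap m) = φ.toLinearMap m ⊗ₜ[R] (1 : A)
    rw [φ.map_coact, hm', LinearMap.rTensor_tmul])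

end RationalModule

/-- Taking invariants is exact on the category of the rational left, resp. right, `G`-modules that
satisfy `P`: it preserves short exact sequences. -/
def RationalInvariantsExactOn (R A : Type u) [CommRing R] [CommRing A] [Bialgebra R A] (σ : Side)
    (P : RationalModule R A σ → Prop) : Prop :=
  ∀ (M₁ M₂ M₃ : RationalModule R A σ) (f : M₁.Hom M₂) (g : M₂.Hom M₃), P M₁ → P M₂ → P M₃ →
    (Function.Injective f.toLinearMap ∧ Function.Exact f.toLinearMap g.toLinearMap ∧
      Function.Surjective g.toLinearMap) →
    (Function.Injective f.invariants ∧ Function.Exact f.invariants g.invariants ∧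
      Function.Surjective g.invariants)

/-! All five conditions amount to the existence of a Reynolds form: a linear form `w` on `A` with `w
1 = 1` that is invariant under left and right translations.

Such a form averages. The linear forms on `A` act on every rational module, and on every dual
functor of `G`-modules after base change. If `x` lifts an invariant `y`, then `w • x` is invariant
because `g * w = w`, and it lifts `w • y = w 1 • y = y`. The action of forms on a dual functor rests
on reflexivity (`exists_eval_eq_evalForm`): a natural linear family `Hom_R(E, T) → T` is evaluation
at an element of `S ⊗ E`. For `E = A` that element is the value at the universal point, so a linear
family on forms with values in a dual functor is determined by the points of `G`
(`IsDual.app_form_eq`). The identities for the action of forms are thereby reduced to points.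

Conversely, little exactness is needed to construct `w`: lifting the invariant `1` along `R`-split
sequences `0 → K → B → R → 0` of finitely generated rational modules (`SplitInvariantsLift`). Split
sequences stay exact after base change, so coherent exactness gives this as well as rational
exactness does. For `a` in `A`, let `B` be the cyclic submodule generated by `b = (a, 1)` in `A ⊕
R`; it is finitely generated since `A` is projective. An invariant lift of `1` is some `u • b` with
`u 1 = 1` and `u • a` a scalar, a mean of `a`. Left and right means exist, and they coincide because
left and right translations commute. The mean is therefore unique, and uniqueness forces it to be
linear and bi-invariant (`exists_isReynolds`).

Quasi-coherent modules are dual, again by reflexivity, which closes the circle of implications. -/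

/-! ### Reflexivity of quasi-coherent modules -/

section Reflexivity

variable {R : Type u} [CommRing R]

/-- The linear map `S ⊗ E → T`, `s ⊗ e ↦ h s * v e`. -/
noncomputable def evalForm {S T E : Type u} [CommRing S] [Algebra R S] [CommRing T] [Algebra R T]
    [AddCommGroup E] [Module R E] (h : S →ₐ[R] T) (v : E →ₗ[R] T) : S ⊗[R] E →ₗ[R] T :=
  LinearMap.mul' R T ∘ₗ TensorProduct.map h.toLinearMap v

section evalForm

variable {S T U E : Type u} [CommRing S] [Algebra R S] [CommRing T] [Algebra R T]
  [CommRing U] [Algebra R U] [AddCommGroup E] [Module R E]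

@[simp]
theorem evalForm_tmul (h : S →ₐ[R] T) (v : E →ₗ[R] T) (s : S) (e : E) :
    evalForm h v (s ⊗ₜ e) = h s * v e := rfl

theorem evalForm_smul (h : S →ₐ[R] T) (v : E →ₗ[R] T) (s : S) (x : S ⊗[R] E) :
    evalForm h v (s • x) = h s * evalForm h v x := by
  induction x using TensorProduct.induction_on with
  | zero => simp
  | tmul a m => simp [TensorProduct.smul_tmul', mul_assoc]
  | add x y hx hy => rw [smul_add, map_add, hx, hy, map_add, mul_add]

theorem evalForm_add_form (h : S →ₐ[R] T) (v v' : E →ₗ[R] T) (x : S ⊗[R] E) :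
    evalForm h (v + v') x = evalForm h v x + evalForm h v' x := by
  simp [evalForm, TensorProduct.map_add_right]

theorem evalForm_smul_form (h : S →ₐ[R] T) (t : T) (v : E →ₗ[R] T) (x : S ⊗[R] E) :
    evalForm h (t • v) x = t * evalForm h v x := by
  induction x using TensorProduct.induction_on with
  | zero => simp
  | tmul a m => simp [mul_left_comm]
  | add x y hx hy => rw [map_add, hx, hy, map_add, mul_add]

theorem evalForm_comp (f : T →ₐ[R] U) (h : S →ₐ[R] T) (v : E →ₗ[R] T) (x : S ⊗[R] E) :
    evalForm (f.comp h) (f.toLinearMap ∘ₗ v) x = f (evalForm h v x) := by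
  induction x using TensorProduct.induction_on with
  | zero => simp
  | tmul a m => simp
  | add x y hx hy => rw [map_add, hx, hy, map_add, map_add]

theorem evalForm_rTensor (h : T →ₐ[R] U) (f : S →ₐ[R] T) (v : E →ₗ[R] U) (x : S ⊗[R] E) :
    evalForm h v (f.toLinearMap.rTensor E x) = evalForm (h.comp f) v x := by
  induction x using TensorProduct.induction_on with
  | zero => simp
  | tmul a m => simp
  | add x y hx hy => rw [map_add, map_add, hx, hy, map_add]

end evalForm

namespace ModFunctor

/-- The functor `T ↦ Hom_R(E, T)`, which is the dual of the quasi-coherent module of `E`. -/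
def linForms (R : Type u) [CommRing R] (E : Type u) [AddCommGroup E] [Module R E] :
    ModFunctor.{u, u + 1} R where
  obj S _ _ := ULift.{u + 1} (E →ₗ[R] S)
  addCommGroup _ _ _ := inferInstance
  module _ _ _ := inferInstance
  map f :=
    { toFun := fun v => ⟨f.toLinearMap ∘ₗ v.down⟩
      map_zero' := by ext; simp
      map_add' := fun a b => by ext; simp }
  map_smul f s m := by ext; simp
  map_id m := rfl
  map_comp g f m := rfl

/-- The value at `m` of a natural family of linear forms. -/
def HomOver.eval {M : ModFunctor.{u, v} R} {S : Type u} [CommRing S] [Algebra R S]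
    (φ : HomOver M (ringFunctor R) S) {T : Type u} [CommRing T] [Algebra R T] (h : S →ₐ[R] T) :
    M.obj T →ₗ[T] T :=
  φ.app T h

theorem HomOver.eval_map {M : ModFunctor.{u, v} R} {S : Type u} [CommRing S] [Algebra R S]
    (φ : HomOver M (ringFunctor R) S) {T U : Type u} [CommRing T] [Algebra R T] [CommRing U]
    [Algebra R U] (h : S →ₐ[R] T) (f : T →ₐ[R] U) (m : M.obj T) :
    φ.eval (f.comp h) (M.map f m) = f (φ.eval h m) :=
  φ.naturality h f m

theorem HomOver.eval_ext {M : ModFunctor.{u, v} R} {S : Type u} [CommRing S] [Algebra R S]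
    {φ ψ : HomOver M (ringFunctor R) S}
    (H : ∀ (T : Type u) [CommRing T] [Algebra R T] (h : S →ₐ[R] T) (m : M.obj T),
      φ.eval h m = ψ.eval h m) : φ = ψ := by
  apply HomOver.ext
  funext T _ _ h
  exact LinearMap.ext fun m => H T h m

variable {E : Type u} [AddCommGroup E] [Module R E] {S : Type u} [CommRing S] [Algebra R S]

/-- A linear form `E → S` as an element of `linForms R E` at `S`. -/
def form : (E →ₗ[R] S) ≃ₗ[S] (linForms R E).obj S :=
  ULift.moduleEquiv.symm

theorem linForms_map {T : Type u} [CommRing T] [Algebra R T] (f : S →ₐ[R] T) (v : E →ₗ[R] S) :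
    (linForms R E).map f (form v) = form (f.toLinearMap ∘ₗ v) := rfl

/-- The morphism `TrivSqZeroExt S (S ⊗ E) → T[ε]` given by `h : S → T` and a form `v : E → T`. -/
noncomputable def trivSqZeroExtToDual {T : Type u} [CommRing T] [Algebra R T] (h : S →ₐ[R] T)
    (v : E →ₗ[R] T) : TrivSqZeroExt S (S ⊗[R] E) →ₐ[R] DualNumber T :=
  TrivSqZeroExt.lift ((TrivSqZeroExt.inlAlgHom R T T).comp h)
    ((TrivSqZeroExt.inrHom T T).restrictScalars R ∘ₗ evalForm h v)
    (by intro x y; simp)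
    (by intro s x; ext <;> simp [evalForm_smul, mul_comm])
    (by intro s x; ext <;> simp [evalForm_smul, mul_comm])

theorem snd_trivSqZeroExtToDual {T : Type u} [CommRing T] [Algebra R T] (h : S →ₐ[R] T)
    (v : E →ₗ[R] T) (z : TrivSqZeroExt S (S ⊗[R] E)) :
    TrivSqZeroExt.snd (trivSqZeroExtToDual h v z) = evalForm h v z.snd := by
  rw [trivSqZeroExtToDual, TrivSqZeroExt.lift_def]
  simp

/-- Reflexivity of quasi-coherent modules: a natural linear family of maps `Hom_R(E, T) → T`, over
the `S`-algebras `T`, is the evaluation at an element of `S ⊗ E`. -/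
theorem exists_eval_eq_evalForm (φ : HomOver (linForms R E) (ringFunctor R) S) :
    ∃ x : S ⊗[R] E, ∀ (T : Type u) [CommRing T] [Algebra R T] (h : S →ₐ[R] T) (v : E →ₗ[R] T),
      φ.eval h (form v) = evalForm h v x := by
  -- The form `univ` sends `e` to the square-zero element `1 ⊗ e`; the desired `x` is the
  -- square-zero component of the value of `φ` there.
  let ι : S →ₐ[R] TrivSqZeroExt S (S ⊗[R] E) := TrivSqZeroExt.inlAlgHom R S _
  let univ : E →ₗ[R] TrivSqZeroExt S (S ⊗[R] E) :=
    (TrivSqZeroExt.inrHom S (S ⊗[R] E)).restrictScalars R ∘ₗ TensorProduct.mk R S E 1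
  refine ⟨TrivSqZeroExt.snd (φ.eval ι (form univ)), fun T _ _ h v => ?_⟩
  have h1 := φ.eval_map ι (trivSqZeroExtToDual h v) (form univ)
  have h2 : (trivSqZeroExtToDual h v).comp ι = (TrivSqZeroExt.inlAlgHom R T T).comp h := by
    ext s <;> simp [trivSqZeroExtToDual, ι]
  -- The universal form specialises to `ε v` rather than to `v`. Linearity of `φ` pulls `ε` out, and
  -- comparing coefficients of `ε` yields the value at `v`.
  have h3 : (trivSqZeroExtToDual h v).toLinearMap ∘ₗ univ =
      (DualNumber.eps : DualNumber T) •
        ((TrivSqZeroExt.inlAlgHom R T T).toLinearMap ∘ₗ v) := by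
    ext e <;> simp [trivSqZeroExtToDual, univ]
  have h4 := φ.eval_map h (TrivSqZeroExt.inlAlgHom R T T) (form v)
  rw [linForms_map] at h1 h4
  rw [h2, h3, _root_.map_smul, _root_.map_smul] at h1
  have h5 := h1.symm.trans (congrArg _ h4)
  have h6 := congrArg (fun z : DualNumber T => TrivSqZeroExt.snd z) h5
  simpa [snd_trivSqZeroExtToDual, eq_comm] using h6

/-- The natural family of forms on `Hom_R(E, T)` given by an element of `S ⊗ E`. -/
noncomputable def evalFamily :
    S ⊗[R] E →ₗ[S] (dual (linForms R E)).obj S where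
  toFun x :=
    ⟨fun _ _ _ h =>
      { toFun := fun v => evalForm h (form.symm v) x
        map_add' := fun v v' => evalForm_add_form h (form.symm v) (form.symm v') x
        map_smul' := fun t v => evalForm_smul_form h t (form.symm v) x },
    fun h f m => evalForm_comp f h (form.symm m) x⟩
  map_add' x y := HomOver.eval_ext fun _ _ _ h v => map_add (evalForm h (form.symm v)) x y
  map_smul' s x := HomOver.eval_ext fun _ _ _ h v => evalForm_smul h (form.symm v) s x

/-- Injectivity holds because evaluating at the universal form with values in the square-zero
extension returns the element itself; surjectivity is reflexivity. -/
theorem evalFamily_bijective :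
    Function.Bijective (evalFamily : S ⊗[R] E →ₗ[S] (dual (linForms R E)).obj S) := by
  constructor
  · intro x y hxy
    let univ : E →ₗ[R] TrivSqZeroExt S (S ⊗[R] E) :=
      (TrivSqZeroExt.inrHom S (S ⊗[R] E)).restrictScalars R ∘ₗ TensorProduct.mk R S E 1
    have huniv (z : S ⊗[R] E) :
        evalForm (TrivSqZeroExt.inlAlgHom R S _) univ z = TrivSqZeroExt.inr z := by
      induction z using TensorProduct.induction_on with
      | zero => simp
      | tmul s e => simp [univ, TrivSqZeroExt.inl_mul_inr, TensorProduct.smul_tmul']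
      | add a b ha hb => rw [map_add, ha, hb, TrivSqZeroExt.inr_add]
    have h := congrArg (fun φ : HomOver (linForms R E) (ringFunctor R) S =>
      φ.eval (TrivSqZeroExt.inlAlgHom R S _) (form univ)) hxy
    exact TrivSqZeroExt.inr_injective ((huniv x).symm.trans (h.trans (huniv y)))
  · intro φ
    obtain ⟨x, hx⟩ := exists_eval_eq_evalForm φ
    exact ⟨x, HomOver.eval_ext fun T _ _ h v => (hx T h (form.symm v)).symm⟩

/-- Quasi-coherent modules are dual functors. -/
theorem IsQuasiCoherent.isDual {M : ModFunctor.{u, u + 1} R} (hM : M.IsQuasiCoherent) :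
    M.IsDual := by
  obtain ⟨E, _, _, ⟨e⟩⟩ := hM
  refine ⟨linForms R E, ⟨⟨fun S _ _ => (e.app S).trans
    (LinearEquiv.ofBijective evalFamily evalFamily_bijective), fun {S T} _ _ _ _ f m => ?_⟩⟩⟩
  refine HomOver.eval_ext fun U _ _ h v => ?_
  have h1 := e.naturality f m
  change evalForm h (form.symm v) (e.app T (M.map f m)) =
    evalForm (h.comp f) (form.symm v) (e.app S m)
  rw [h1]
  exact evalForm_rTensor h f (form.symm v) (e.app S m)

theorem IsCoherent.isQuasiCoherent {M : ModFunctor.{u, u + 1} R} (hM : M.IsCoherent) :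
    M.IsQuasiCoherent := by
  obtain ⟨E, _, _, _, e⟩ := hM
  exact ⟨E, _, _, e⟩

end ModFunctor
end Reflexivity

/-! ### Families with values in a dual functor are determined by points -/

theorem evalForm_includeLeft_includeRight {R T A : Type u} [CommRing R] [CommRing T] [Algebra R T]
    [CommRing A] [Algebra R A] (x : T ⊗[R] A) :
    evalForm Algebra.TensorProduct.includeLeft
      (Algebra.TensorProduct.includeRight : A →ₐ[R] T ⊗[R] A).toLinearMap x = x := by
  induction x using TensorProduct.induction_on with
  | zero => simp
  | tmul a b => simp
  | add x y hx hy => rw [map_add, hx, hy]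

namespace ModFunctor

variable {R : Type u} [CommRing R] {M N : ModFunctor.{u, u + 1} R}

/-- The pairing of `M ≅ N*` with `N` at the algebra `T`. -/
def Iso.pair (e : Iso M (dual N)) {T : Type u} [CommRing T] [Algebra R T] :
    M.obj T →ₗ[T] N.obj T →ₗ[T] T where
  toFun x := HomOver.eval (e.app T x) (AlgHom.id R T)
  map_add' x y := by rw [_root_.map_add]; rfl
  map_smul' t x := by rw [_root_.map_smul]; rfl

theorem Iso.eval_app (e : Iso M (dual N)) {S T : Type u} [CommRing S] [Algebra R S] [CommRing T]
    [Algebra R T] (h : S →ₐ[R] T) (x : M.obj S) (n : N.obj T) :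
    HomOver.eval (e.app S x) h n = e.pair (M.map h x) n := by
  change _ = HomOver.eval (e.app T (M.map h x)) (AlgHom.id R T) n
  rw [e.naturality]
  rfl

theorem Iso.pair_map (e : Iso M (dual N)) {S T : Type u} [CommRing S] [Algebra R S] [CommRing T]
    [Algebra R T] (h : S →ₐ[R] T) (x : M.obj S) (n : N.obj S) :
    e.pair (M.map h x) (N.map h n) = h (e.pair x n) := by
  rw [← e.eval_app]
  exact HomOver.eval_map (e.app S x) (AlgHom.id R S) h n

theorem Iso.pair_ext (e : Iso M (dual N)) {S : Type u} [CommRing S] [Algebra R S] {x y : M.obj S}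
    (H : ∀ (T : Type u) [CommRing T] [Algebra R T] (h : S →ₐ[R] T) (n : N.obj T),
      e.pair (M.map h x) n = e.pair (M.map h y) n) : x = y := by
  apply (e.app S).injective
  refine HomOver.eval_ext fun T _ _ h n => ?_
  rw [e.eval_app, e.eval_app, H]

theorem Iso.pair_map_symm (e : Iso M (dual N)) {S T : Type u} [CommRing S] [Algebra R S]
    [CommRing T] [Algebra R T] (φ : (dual N).obj S) (h : S →ₐ[R] T) (n : N.obj T) :
    e.pair (M.map h ((e.app S).symm φ)) n = HomOver.eval φ h n := by
  rw [← e.eval_app, LinearEquiv.apply_symm_apply]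

theorem HomOver.map_app {M : ModFunctor.{u, v} R} {N : ModFunctor.{u, w} R} {S : Type u}
    [CommRing S] [Algebra R S] (F : HomOver M N S) {T U : Type u} [CommRing T] [Algebra R T]
    [CommRing U] [Algebra R U] (h : S →ₐ[R] T) (f : T →ₐ[R] U) (m : M.obj T) :
    N.map f (F.app T h m) = F.app U (f.comp h) (M.map f m) :=
  (F.naturality h f m).symm

/-- A natural linear family of maps from `Hom_R(A, T)` to a dual functor is determined by its
values at the morphisms of algebras. -/
theorem IsDual.app_form_eq {A : Type u} [CommRing A] [Algebra R A] (hM : M.IsDual) {S : Type u}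
    [CommRing S] [Algebra R S] (F G : HomOver (linForms R A) M S)
    (H : ∀ (T : Type u) [CommRing T] [Algebra R T] (h : S →ₐ[R] T) (g : A →ₐ[R] T),
      F.app T h (form g.toLinearMap) = G.app T h (form g.toLinearMap))
    (v : A →ₗ[R] S) :
    F.app S (AlgHom.id R S) (form v) = G.app S (AlgHom.id R S) (form v) := by
  obtain ⟨N, ⟨e⟩⟩ := hM
  refine e.pair_ext fun T _ _ k n => ?_
  rw [HomOver.map_app, HomOver.map_app, linForms_map]
  -- Pairing with `n` turns `F` into a scalar-valued family, to which reflexivity applies.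
  let P (F : HomOver (linForms R A) M S) : HomOver (linForms R A) (ringFunctor R) T :=
    ⟨fun C _ _ l => e.pair.flip (N.map l n) ∘ₗ F.app C (l.comp k), fun {C D} _ _ _ _ l f v => by
      change e.pair (F.app D ((f.comp l).comp k) _) (N.map (f.comp l) n) =
        f (e.pair (F.app C (l.comp k) v) (N.map l n))
      rw [← e.pair_map, HomOver.map_app, N.map_comp]
      rfl⟩
  -- The representing element is recovered from the universal point `A → T ⊗ A`, which is a morphism
  -- of algebras, so `H` applies there.
  have key (F : HomOver (linForms R A) M S) (x : T ⊗[R] A)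
      (hx : ∀ (C : Type u) [CommRing C] [Algebra R C] (l : T →ₐ[R] C) (v : A →ₗ[R] C),
        (P F).eval l (form v) = evalForm l v x) :
      x = (P F).eval Algebra.TensorProduct.includeLeft
        (form (Algebra.TensorProduct.includeRight : A →ₐ[R] T ⊗[R] A).toLinearMap) := by
    rw [hx, evalForm_includeLeft_includeRight]
  obtain ⟨x, hx⟩ := exists_eval_eq_evalForm (P F)
  obtain ⟨y, hy⟩ := exists_eval_eq_evalForm (P G)
  have hxy : x = y := by
    rw [key F x hx, key G y hy]
    change e.pair (F.app _ _ _) _ = e.pair (G.app _ _ _) _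
    rw [H]
  have hF := hx T (AlgHom.id R T) (k.toLinearMap ∘ₗ v)
  have hG := hy T (AlgHom.id R T) (k.toLinearMap ∘ₗ v)
  rw [← hxy, ← hF] at hG
  have h1 := hG.symm
  change e.pair (F.app T _ _) (N.map (AlgHom.id R T) n) =
    e.pair (G.app T _ _) (N.map (AlgHom.id R T) n) at h1
  rwa [N.map_id] at h1

end ModFunctor

/-! ### Products of points and linear forms -/

/-- The product `g * v` of a point and a linear form, for left actions, resp. `v * g`, for right
actions. -/
noncomputable def Side.mulForm {R A T : Type u} [CommRing R] [CommRing A] [Bialgebra R A]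
    [CommRing T] [Algebra R T] (σ : Side) (g : Points R A T) (v : A →ₗ[R] T) : A →ₗ[R] T :=
  LinearMap.mul' R T ∘ₗ TensorProduct.map g.ofConv.toLinearMap v ∘ₗ σ.comul R A

section mulForm

variable {R A T U : Type u} [CommRing R] [CommRing A] [Bialgebra R A] [CommRing T] [Algebra R T]
  [CommRing U] [Algebra R U] {σ : Side}

theorem Side.mul_ofConv_toLinearMap (σ : Side) (g h : Points R A T) :
    (σ.mul g h).ofConv.toLinearMap = σ.mulForm g h.ofConv.toLinearMap := by
  cases σ with
  | left => rfl
  | right =>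
    change LinearMap.mul' R T ∘ₗ TensorProduct.map h.ofConv.toLinearMap g.ofConv.toLinearMap ∘ₗ
      Coalgebra.comul = LinearMap.mul' R T ∘ₗ TensorProduct.map g.ofConv.toLinearMap
        h.ofConv.toLinearMap ∘ₗ (TensorProduct.comm R A A).toLinearMap ∘ₗ Coalgebra.comul
    simp only [← LinearMap.comp_assoc]
    congr 1
    ext a b
    simp [mul_comm]

theorem Side.mulForm_add (g : Points R A T) (v v' : A →ₗ[R] T) :
    σ.mulForm g (v + v') = σ.mulForm g v + σ.mulForm g v' := by
  ext a
  simp [Side.mulForm, TensorProduct.map_add_right]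

theorem Side.mulForm_smul (g : Points R A T) (t : T) (v : A →ₗ[R] T) :
    σ.mulForm g (t • v) = t • σ.mulForm g v := by
  have h : LinearMap.mul' R T ∘ₗ TensorProduct.map g.ofConv.toLinearMap (t • v) =
      t • (LinearMap.mul' R T ∘ₗ TensorProduct.map g.ofConv.toLinearMap v) := by
    ext a b
    simp [mul_left_comm]
  ext a
  exact LinearMap.congr_fun h (σ.comul R A a)

theorem Side.comp_mulForm (f : T →ₐ[R] U) (g : Points R A T) (v : A →ₗ[R] T) :
    f.toLinearMap ∘ₗ σ.mulForm g v = σ.mulForm (Points.map f g) (f.toLinearMap ∘ₗ v) := by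
  have h : f.toLinearMap ∘ₗ LinearMap.mul' R T ∘ₗ TensorProduct.map g.ofConv.toLinearMap v =
      LinearMap.mul' R U ∘ₗ TensorProduct.map (Points.map f g).ofConv.toLinearMap
        (f.toLinearMap ∘ₗ v) := by
    ext a b
    simp [Points.map]
  ext a
  exact LinearMap.congr_fun h (σ.comul R A a)

/-- A linear form `w` on `A` that is invariant (for the side `σ`) is fixed by all points. -/
theorem Side.mulForm_of_invariant (g : Points R A T) (w : A →ₗ[R] R)
    (hw : ∀ a, (TensorProduct.rid R A) (w.lTensor A (σ.comul R A a)) = w a • 1) :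
    σ.mulForm g (Algebra.linearMap R T ∘ₗ w) = Algebra.linearMap R T ∘ₗ w := by
  have h : LinearMap.mul' R T ∘ₗ TensorProduct.map g.ofConv.toLinearMap
      (Algebra.linearMap R T ∘ₗ w) =
      g.ofConv.toLinearMap ∘ₗ (TensorProduct.rid R A).toLinearMap ∘ₗ w.lTensor A := by
    ext a b
    simp [Algebra.smul_def, mul_comm]
  ext a
  refine (LinearMap.congr_fun h (σ.comul R A a)).trans ?_
  change g.ofConv ((TensorProduct.rid R A) (w.lTensor A (σ.comul R A a))) = _
  rw [hw, map_smul, map_one]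
  simp [Algebra.smul_def]

end mulForm

/-- The universal point of `G` with values in `T ⊗ A`. -/
noncomputable def Points.univ (R A T : Type u) [CommRing R] [CommRing A] [Bialgebra R A] [CommRing T]
    [Algebra R T] : Points R A (T ⊗[R] A) :=
  toConv Algebra.TensorProduct.includeRight

/-! ### Linear forms acting on dual functors of `G`-modules -/

namespace GModFunctor

variable {R A : Type u} [CommRing R] [CommRing A] [Bialgebra R A] {σ : Side}
  {M : GModFunctor.{u, u + 1} R A σ} {N : ModFunctor.{u, u + 1} R}

open ModFunctor

section linAct

variable (e : Iso M.toModFunctor (dual N)) {S T : Type u} [CommRing S] [Algebra R S]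
  [CommRing T] [Algebra R T]

/-- The orbit function `g ↦ ⟨g • m, n⟩` on `G`, as an element of `T ⊗ A`. -/
noncomputable def orbitFun (m : M.obj T) (n : N.obj T) : T ⊗[R] A :=
  e.pair (M.act (Points.univ R A T) (M.map Algebra.TensorProduct.includeLeft m))
    (N.map Algebra.TensorProduct.includeLeft n)

theorem orbitFun_add (m : M.obj T) (n n' : N.obj T) :
    orbitFun e m (n + n') = orbitFun e m n + orbitFun e m n' := by
  simp [orbitFun]

theorem orbitFun_smul (m : M.obj T) (t : T) (n : N.obj T) :
    orbitFun e m (t • n) = t • orbitFun e m n := by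
  rw [orbitFun, N.map_smul, _root_.map_smul, orbitFun, smul_eq_mul, Algebra.smul_def]
  rfl

theorem orbitFun_map (f : S →ₐ[R] T) (m : M.obj S) (n : N.obj S) :
    orbitFun e (M.map f m) (N.map f n) = f.toLinearMap.rTensor A (orbitFun e m n) := by
  let k : S ⊗[R] A →ₐ[R] T ⊗[R] A := Algebra.TensorProduct.map f (AlgHom.id R A)
  have h1 : k.comp Algebra.TensorProduct.includeLeft =
      Algebra.TensorProduct.includeLeft.comp f := by ext; simp [k]
  have h2 : Points.map k (Points.univ R A S) = Points.univ R A T := by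
    apply WithConv.ofConv_injective
    ext a
    simp [k, Points.map, Points.univ]
  calc
    _ = k (orbitFun e m n) := by
      rw [orbitFun, orbitFun, ← e.pair_map, M.map_act, h2, ← M.map_comp k, ← N.map_comp k, h1,
        M.map_comp, N.map_comp]
    _ = _ := rfl

/-- Every point is a specialisation of the universal one, along the morphism `T ⊗ A → T` that is the
identity on `T` and `g` on `A`. -/
theorem evalForm_orbitFun (g : Points R A T) (m : M.obj T) (n : N.obj T) :
    evalForm (AlgHom.id R T) g.ofConv.toLinearMap (orbitFun e m n) = e.pair (M.act g m) n := by
  let k : T ⊗[R] A →ₐ[R] T := Algebra.TensorProduct.lift (AlgHom.id R T) g.ofConv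
    (fun _ _ => Commute.all _ _)
  have h1 : k.comp Algebra.TensorProduct.includeLeft = AlgHom.id R T := by ext; simp [k]
  have h2 : Points.map k (Points.univ R A T) = g := by
    apply WithConv.ofConv_injective
    ext a
    simp [k, Points.map, Points.univ]
  calc
    _ = k (orbitFun e m n) := by
      induction orbitFun e m n using TensorProduct.induction_on with
      | zero => simp
      | tmul t a => simp [k]
      | add x y hx hy => rw [map_add, map_add, hx, hy]
    _ = _ := by
      rw [orbitFun, ← e.pair_map, M.map_act, h2, ← M.map_comp, ← N.map_comp, h1, M.map_id,
        N.map_id]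

/-- The action of a linear form `v : A → S` on `m ∈ 𝕄(S)`, for a dual functor `𝕄`. -/
noncomputable def linAct (v : A →ₗ[R] S) (m : M.obj S) : M.obj S :=
  (e.app S).symm
    ⟨fun T _ _ h =>
      { toFun := fun n => evalForm (AlgHom.id R T) (h.toLinearMap ∘ₗ v) (orbitFun e (M.map h m) n)
        map_add' := fun n n' => by rw [orbitFun_add, _root_.map_add]; rfl
        map_smul' := fun t n => by rw [orbitFun_smul, evalForm_smul]; rfl },
    fun {T U} _ _ _ _ h f n => by
      change evalForm (AlgHom.id R U) (f.toLinearMap ∘ₗ h.toLinearMap ∘ₗ v)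
          (orbitFun e (M.map (f.comp h) m) (N.map f n)) =
        f (evalForm (AlgHom.id R T) (h.toLinearMap ∘ₗ v) (orbitFun e (M.map h m) n))
      rw [M.map_comp, orbitFun_map, evalForm_rTensor, ← evalForm_comp]
      rfl⟩

theorem pair_map_linAct (v : A →ₗ[R] S) (m : M.obj S) (h : S →ₐ[R] T) (n : N.obj T) :
    e.pair (M.map h (linAct e v m)) n =
      evalForm (AlgHom.id R T) (h.toLinearMap ∘ₗ v) (orbitFun e (M.map h m) n) :=
  e.pair_map_symm _ h n

theorem linAct_point (g : Points R A S) (m : M.obj S) :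
    linAct e g.ofConv.toLinearMap m = M.act g m := by
  refine e.pair_ext fun T _ _ h n => ?_
  rw [pair_map_linAct, M.map_act, ← evalForm_orbitFun]
  rfl

theorem linAct_add (v v' : A →ₗ[R] S) (m : M.obj S) :
    linAct e (v + v') m = linAct e v m + linAct e v' m := by
  refine e.pair_ext fun T _ _ h n => ?_
  rw [_root_.map_add, _root_.map_add, LinearMap.add_apply, pair_map_linAct, pair_map_linAct,
    pair_map_linAct, LinearMap.comp_add, evalForm_add_form]

theorem linAct_smul (s : S) (v : A →ₗ[R] S) (m : M.obj S) :
    linAct e (s • v) m = s • linAct e v m := by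
  refine e.pair_ext fun T _ _ h n => ?_
  have h1 : h.toLinearMap ∘ₗ (s • v) = h s • (h.toLinearMap ∘ₗ v) := by ext; simp
  rw [M.map_smul, _root_.map_smul, LinearMap.smul_apply, pair_map_linAct, pair_map_linAct, h1,
    evalForm_smul_form, smul_eq_mul]

theorem map_linAct (f : S →ₐ[R] T) (v : A →ₗ[R] S) (m : M.obj S) :
    M.map f (linAct e v m) = linAct e (f.toLinearMap ∘ₗ v) (M.map f m) := by
  refine e.pair_ext fun T _ _ h n => ?_
  rw [← M.map_comp, pair_map_linAct, pair_map_linAct, M.map_comp]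
  rfl

/-- The natural linear extension `v ↦ v • m` of the orbit map `g ↦ g • m`. -/
noncomputable def linActFamily (m : M.obj S) : HomOver (linForms R A) M.toModFunctor S :=
  ⟨fun T _ _ h =>
    { toFun := fun v => linAct e (form.symm v) (M.map h m)
      map_add' := fun v v' => linAct_add e (form.symm v) (form.symm v') _
      map_smul' := fun t v => linAct_smul e t (form.symm v) _ },
  fun h f v => by
    change linAct e (f.toLinearMap ∘ₗ form.symm v) (M.map (f.comp h) m) =
      M.map f (linAct e (form.symm v) (M.map h m))
    rw [map_linAct, M.map_comp]⟩

/-- Both sides extend to natural linear families in `v`. At a point `g` both equal `m`, by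
invariance and by `g 1 = 1`, so they agree on all forms. The next two results follow the same
pattern. -/
theorem linAct_of_mem_invariants (v : A →ₗ[R] S) {m : M.obj S} (hm : m ∈ M.invariantsAt S) :
    linAct e v m = v 1 • m := by
  let F : HomOver (linForms R A) M.toModFunctor S :=
    ⟨fun T _ _ h =>
      { toFun := fun v => form.symm v 1 • M.map h m
        map_add' := fun v v' => add_smul (form.symm v 1) (form.symm v' 1) _
        map_smul' := fun t v => mul_smul t (form.symm v 1) _ },
    fun h f v => by
      change f (form.symm v 1) • M.map (f.comp h) m = M.map f (form.symm v 1 • M.map h m)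
      rw [M.map_smul, M.map_comp]⟩
  have h := IsDual.app_form_eq ⟨N, ⟨e⟩⟩ (linActFamily e m) F (fun T _ _ h g => by
    change linAct e (toConv g : Points R A T).ofConv.toLinearMap (M.map h m) = g 1 • M.map h m
    rw [linAct_point, hm, map_one, one_smul]) v
  change linAct e v (M.map (AlgHom.id R S) m) = v 1 • M.map (AlgHom.id R S) m at h
  rwa [M.map_id] at h

/-- When `v` is itself a point this is the associativity of the action; `IsDual.app_form_eq` extends
it to all forms. -/
theorem act_linAct (g : Points R A S) (v : A →ₗ[R] S) (m : M.obj S) :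
    M.act g (linAct e v m) = linAct e (σ.mulForm g v) m := by
  let F : HomOver (linForms R A) M.toModFunctor S :=
    ⟨fun T _ _ h => M.act (Points.map h g) ∘ₗ (linActFamily e m).app T h,
    fun h f v => by
      change M.act (Points.map f (Points.map h g)) ((linActFamily e m).app _ _ _) =
        M.map f (M.act (Points.map h g) ((linActFamily e m).app _ h v))
      rw [M.map_act, HomOver.map_app]⟩
  let F' : HomOver (linForms R A) M.toModFunctor S :=
    ⟨fun T _ _ h =>
      { toFun := fun v => linAct e (σ.mulForm (Points.map h g) (form.symm v)) (M.map h m)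
        map_add' := fun v v' => by
          rw [_root_.map_add, Side.mulForm_add, linAct_add]
        map_smul' := fun t v => by
          rw [_root_.map_smul, Side.mulForm_smul, linAct_smul]; rfl },
    fun h f v => by
      change linAct e (σ.mulForm (Points.map f (Points.map h g)) (f.toLinearMap ∘ₗ form.symm v))
          (M.map (f.comp h) m) =
        M.map f (linAct e (σ.mulForm (Points.map h g) (form.symm v)) (M.map h m))
      rw [map_linAct, M.map_comp, Side.comp_mulForm]⟩
  have h := IsDual.app_form_eq ⟨N, ⟨e⟩⟩ F F' (fun T _ _ h k => by
    change M.act (Points.map h g) (linAct e (toConv k : Points R A T).ofConv.toLinearMap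
      (M.map h m)) = linAct e (σ.mulForm (Points.map h g)
        (toConv k : Points R A T).ofConv.toLinearMap) (M.map h m)
    rw [linAct_point, ← Side.mul_ofConv_toLinearMap, linAct_point, M.act_mul]) v
  change M.act g (linAct e v (M.map (AlgHom.id R S) m)) =
    linAct e (σ.mulForm g v) (M.map (AlgHom.id R S) m) at h
  rwa [M.map_id] at h

theorem Hom.app_linAct {M' : GModFunctor.{u, u + 1} R A σ} {N' : ModFunctor.{u, u + 1} R}
    (e' : Iso M'.toModFunctor (dual N')) (φ : M.Hom M') (v : A →ₗ[R] S) (m : M.obj S) :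
    φ.app S (linAct e v m) = linAct e' v (φ.app S m) := by
  let F : HomOver (linForms R A) M'.toModFunctor S :=
    ⟨fun T _ _ h => φ.app T ∘ₗ (linActFamily e m).app T h,
    fun h f v => by
      change φ.app _ ((linActFamily e m).app _ _ _) =
        M'.map f (φ.app _ ((linActFamily e m).app _ h v))
      rw [← φ.naturality, HomOver.map_app]⟩
  have h := IsDual.app_form_eq ⟨N', ⟨e'⟩⟩ F (linActFamily e' (φ.app S m)) (fun T _ _ h k => by
    change φ.app T (linAct e (toConv k : Points R A T).ofConv.toLinearMap (M.map h m)) =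
      linAct e' (toConv k : Points R A T).ofConv.toLinearMap (M'.map h (φ.app S m))
    rw [linAct_point, linAct_point, φ.map_act, φ.naturality]) v
  change φ.app S (linAct e v (M.map (AlgHom.id R S) m)) =
    linAct e' v (M'.map (AlgHom.id R S) (φ.app S m)) at h
  rwa [M.map_id, M'.map_id] at h

end linAct

end GModFunctor

/-! ### Averaging with a Reynolds form on dual functors -/

/-- The invariants of a short exact sequence of functors of `G`-modules form a left exact
sequence. -/
theorem GModFunctor.invariants_leftExact {R A : Type u} [CommRing R] [CommRing A] [Bialgebra R A]
    {σ : Side} {M₁ M₂ M₃ : GModFunctor.{u, v} R A σ} (f : M₁.Hom M₂) (g : M₂.Hom M₃)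
    (h : ModFunctor.IsShortExact f.toHom g.toHom) (S : Type u) [CommRing S] [Algebra R S] :
    Function.Injective (f.invariants.app S) ∧
      Function.Exact (f.invariants.app S) (g.invariants.app S) := by
  refine ⟨fun x y hxy => Subtype.ext ((h S).1 (congrArg Subtype.val hxy)), fun y => ⟨?_, ?_⟩⟩
  · intro hy
    obtain ⟨x, hx⟩ := ((h S).2.1 y.1).1 (congrArg Subtype.val hy)
    refine ⟨⟨x, fun T _ _ k p => (h T).1 ?_⟩, Subtype.ext hx⟩
    rw [f.map_act, f.naturality, hx, y.2 T k p]
  · rintro ⟨x, rfl⟩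
    exact Subtype.ext (((h S).2.1 _).2 ⟨x.1, rfl⟩)

/-- A bi-invariant linear form `w` on `A` with `w 1 = 1`. -/
structure IsReynolds {R A : Type u} [CommRing R] [CommRing A] [Bialgebra R A] (w : A →ₗ[R] R) :
    Prop where
  map_one : w 1 = 1
  invariant : ∀ (σ : Side) (a : A),
    TensorProduct.rid R A (w.lTensor A (σ.comul R A a)) = w a • 1

/-- Only surjectivity needs `w`: an arbitrary lift `x` of an invariant `y` is replaced by `w • x`,
which is fixed by all points and still maps to `w 1 • y = y`. -/
theorem IsReynolds.invariantsExactOn_isDual {R A : Type u} [CommRing R] [CommRing A]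
    [Bialgebra R A] {w : A →ₗ[R] R} (hw : IsReynolds w) (σ : Side) :
    InvariantsExactOn R A σ ModFunctor.IsDual := by
  rintro M₁ M₂ M₃ f g - ⟨N₂, ⟨e₂⟩⟩ ⟨N₃, ⟨e₃⟩⟩ h S _ _
  refine ⟨(GModFunctor.invariants_leftExact f g h S).1,
    (GModFunctor.invariants_leftExact f g h S).2, fun y => ?_⟩
  obtain ⟨x, hx⟩ := (h S).2.2 y.1
  let wS (T : Type u) [CommRing T] [Algebra R T] : A →ₗ[R] T := Algebra.linearMap R T ∘ₗ w
  refine ⟨⟨GModFunctor.linAct e₂ (wS S) x, fun T _ _ k p => ?_⟩, Subtype.ext ?_⟩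
  · have hk : k.toLinearMap ∘ₗ wS S = wS T := by ext; simp [wS]
    rw [GModFunctor.map_linAct, hk, GModFunctor.act_linAct,
      Side.mulForm_of_invariant p w (hw.invariant σ)]
  · change g.app S (GModFunctor.linAct e₂ (wS S) x) = y.1
    rw [GModFunctor.Hom.app_linAct e₂ e₃, hx, GModFunctor.linAct_of_mem_invariants e₃ _ y.2]
    simp [wS, hw.map_one]

/-! ### Linear forms acting on rational modules, and averaging there -/

section slice

variable {R A M N : Type u} [CommRing R] [CommRing A] [Algebra R A] [AddCommGroup M] [Module R M]
  [AddCommGroup N] [Module R N]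

/-- The contraction `M ⊗ A → M` with a linear form on `A`. -/
noncomputable def slice (u : A →ₗ[R] R) : M ⊗[R] A →ₗ[R] M :=
  (TensorProduct.rid R M).toLinearMap ∘ₗ u.lTensor M

@[simp]
theorem slice_tmul (u : A →ₗ[R] R) (m : M) (a : A) : slice u (m ⊗ₜ[R] a) = u a • m := by
  simp [slice]

theorem slice_rTensor (u : A →ₗ[R] R) (f : M →ₗ[R] N) (x : M ⊗[R] A) :
    slice u (f.rTensor A x) = f (slice u x) := by
  have h : slice u ∘ₗ f.rTensor A = f ∘ₗ slice u := by ext; simp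
  exact LinearMap.congr_fun h x

end slice

namespace RationalModule

variable {R A : Type u} [CommRing R] [CommRing A] [Bialgebra R A] {σ : Side}

theorem assoc_coact (M : RationalModule R A σ) (m : M.carrier) :
    TensorProduct.assoc R M.carrier A A (M.coact.rTensor A (M.coact m)) =
      (σ.comul R A).lTensor M.carrier (M.coact m) :=
  LinearMap.congr_fun M.coassoc m

theorem slice_counit_coact (M : RationalModule R A σ) (m : M.carrier) :
    slice (Coalgebra.counit (R := R) (A := A)) (M.coact m) = m :=
  LinearMap.congr_fun M.counit_coact m

/-- The invariants of a short exact sequence of rational modules form a left exact sequence. -/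
theorem invariants_leftExact [Module.Flat R A] {M₁ M₂ M₃ : RationalModule R A σ} (f : M₁.Hom M₂)
    (g : M₂.Hom M₃) (hf : Function.Injective f.toLinearMap)
    (hfg : Function.Exact f.toLinearMap g.toLinearMap) :
    Function.Injective f.invariants ∧ Function.Exact f.invariants g.invariants := by
  refine ⟨fun x y hxy => Subtype.ext (hf (congrArg Subtype.val hxy)), fun y => ⟨?_, ?_⟩⟩
  · intro hy
    obtain ⟨x, hx⟩ := (hfg y.1).1 (congrArg Subtype.val hy)
    refine ⟨⟨x, ?_⟩, Subtype.ext hx⟩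
    -- Flatness of `A` allows the invariance of `x` to be tested after mapping to `M₂ ⊗ A`.
    apply Module.Flat.rTensor_preserves_injective_linearMap (M := A) f.toLinearMap hf
    have hy' : M₂.coact y.1 = y.1 ⊗ₜ[R] (1 : A) := y.2
    rw [← f.map_coact, hx, hy']
    simp [hx]
  · rintro ⟨x, rfl⟩
    exact Subtype.ext ((hfg _).2 ⟨x.1, rfl⟩)

/-- The action of a linear form on a rational module. -/
noncomputable def formAct (M : RationalModule R A σ) (u : A →ₗ[R] R) :
    M.carrier →ₗ[R] M.carrier :=
  slice u ∘ₗ M.coact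

/-- Coassociativity transfers the form from the module to a translation of the factor `A`. -/
theorem coact_formAct (M : RationalModule R A σ) (u : A →ₗ[R] R) (m : M.carrier) :
    M.coact (M.formAct u m) = (slice u ∘ₗ σ.comul R A).lTensor M.carrier (M.coact m) := by
  have h : M.coact ∘ₗ slice u = (slice u).lTensor M.carrier ∘ₗ
      (TensorProduct.assoc R M.carrier A A).toLinearMap ∘ₗ M.coact.rTensor A := by
    ext m a
    change M.coact (slice u (m ⊗ₜ a)) = (slice u).lTensor M.carrier
      (TensorProduct.assoc R M.carrier A A (M.coact m ⊗ₜ a))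
    rw [slice_tmul, map_smul]
    induction M.coact m using TensorProduct.induction_on with
    | zero => simp
    | tmul m' b => simp
    | add x y hx hy => rw [smul_add, hx, hy, TensorProduct.add_tmul, map_add, map_add]
  refine (LinearMap.congr_fun h (M.coact m)).trans ?_
  change (slice u).lTensor M.carrier (TensorProduct.assoc R M.carrier A A
    (M.coact.rTensor A (M.coact m))) = _
  rw [M.assoc_coact, LinearMap.lTensor_comp_apply]

/-- The linear forms act through a convolution product, so the multiples `u • b` of one element are
stable under all forms. -/
theorem formAct_formAct (M : RationalModule R A σ) (u v : A →ₗ[R] R) (m : M.carrier) :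
    M.formAct v (M.formAct u m) = M.formAct (v ∘ₗ slice u ∘ₗ σ.comul R A) m := by
  have h (y : M.carrier ⊗[R] A) (f : A →ₗ[R] A) :
      slice v (f.lTensor M.carrier y) = slice (v ∘ₗ f) y := by
    induction y using TensorProduct.induction_on with
    | zero => simp
    | tmul m b => simp
    | add x y hx hy => rw [map_add, map_add, hx, hy, map_add]
  change slice v (M.coact (M.formAct u m)) = _
  rw [coact_formAct, h]
  rfl

theorem Hom.map_formAct {M N : RationalModule R A σ} (f : M.Hom N) (u : A →ₗ[R] R)
    (m : M.carrier) : f.toLinearMap (M.formAct u m) = N.formAct u (f.toLinearMap m) := by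
  change _ = slice u (N.coact (f.toLinearMap m))
  rw [f.map_coact, slice_rTensor]
  rfl

theorem formAct_of_mem_invariants (M : RationalModule R A σ) (u : A →ₗ[R] R) {m : M.carrier}
    (hm : m ∈ M.invariants) : M.formAct u m = u 1 • m := by
  have hm' : M.coact m = m ⊗ₜ[R] (1 : A) := hm
  change slice u (M.coact m) = _
  rw [hm', slice_tmul]

theorem formAct_mem_invariants (M : RationalModule R A σ) {w : A →ₗ[R] R}
    (hw : ∀ a, slice w (σ.comul R A a) = w a • 1) (m : M.carrier) :
    M.formAct w m ∈ M.invariants := by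
  change M.coact (M.formAct w m) = M.formAct w m ⊗ₜ[R] (1 : A)
  rw [coact_formAct]
  change _ = slice w (M.coact m) ⊗ₜ[R] (1 : A)
  have h : slice w ∘ₗ σ.comul R A = w.smulRight 1 := by ext a; exact hw a
  rw [h]
  induction M.coact m using TensorProduct.induction_on with
  | zero => simp
  | tmul m b => simp [TensorProduct.smul_tmul]
  | add x y hx hy => rw [map_add, hx, hy, map_add, TensorProduct.add_tmul]

end RationalModule

theorem IsReynolds.rationalInvariantsExactOn {R A : Type u} [CommRing R] [CommRing A]
    [Bialgebra R A] [Module.Flat R A] {w : A →ₗ[R] R} (hw : IsReynolds w) (σ : Side) :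
    RationalInvariantsExactOn R A σ (fun _ => True) := by
  rintro M₁ M₂ M₃ f g - - - ⟨hf, hfg, hg⟩
  refine ⟨(RationalModule.invariants_leftExact f g hf hfg).1,
    (RationalModule.invariants_leftExact f g hf hfg).2, fun y => ?_⟩
  obtain ⟨x, hx⟩ := hg y.1
  refine ⟨⟨M₂.formAct w x, M₂.formAct_mem_invariants (hw.invariant σ) x⟩, Subtype.ext ?_⟩
  change g.toLinearMap (M₂.formAct w x) = y.1
  rw [g.map_formAct, hx, M₃.formAct_of_mem_invariants w y.2, hw.map_one, one_smul]

/-! ### Lifting invariants along split sequences -/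

/-- Invariants of finitely generated rational modules lift along equivariant morphisms which have
an `R`-linear section. -/
def SplitInvariantsLift (R A : Type u) [CommRing R] [CommRing A] [Bialgebra R A] (σ : Side) :
    Prop :=
  ∀ (M₁ M₂ M₃ : RationalModule R A σ) (f : M₁.Hom M₂) (g : M₂.Hom M₃)
    (s : M₃.carrier →ₗ[R] M₂.carrier), Module.Finite R M₁.carrier → Module.Finite R M₂.carrier →
    Module.Finite R M₃.carrier → Function.Injective f.toLinearMap →
    Function.Exact f.toLinearMap g.toLinearMap → g.toLinearMap ∘ₗ s = LinearMap.id →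
    ∀ m ∈ M₃.invariants, ∃ m' ∈ M₂.invariants, g.toLinearMap m' = m

theorem RationalInvariantsExactOn.splitInvariantsLift {R A : Type u} [CommRing R] [CommRing A]
    [Bialgebra R A] {σ : Side}
    (H : RationalInvariantsExactOn R A σ (fun M => Module.Finite R M.carrier)) :
    SplitInvariantsLift R A σ := by
  intro M₁ M₂ M₃ f g s h₁ h₂ h₃ hf hfg hs m hm
  obtain ⟨-, -, h⟩ := H M₁ M₂ M₃ f g h₁ h₂ h₃
    ⟨hf, hfg, fun y => ⟨s y, LinearMap.congr_fun hs y⟩⟩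
  obtain ⟨m', hm'⟩ := h ⟨m, hm⟩
  exact ⟨m'.1, m'.2, congrArg Subtype.val hm'⟩

/-! ### The functor of `G`-modules of a rational module -/

namespace RationalModule

variable {R A : Type u} [CommRing R] [CommRing A] [Bialgebra R A] {σ : Side}

section toGModFunctor

variable (M : RationalModule R A σ) {S T : Type u} [CommRing S] [Algebra R S] [CommRing T]
  [Algebra R T]

/-- The map `M → S ⊗ M`, `m ↦ g • (1 ⊗ m)`, for a point `g ∈ G(S)`. -/
noncomputable def pointMap (g : Points R A S) : M.carrier →ₗ[R] S ⊗[R] M.carrier :=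
  (TensorProduct.comm R M.carrier S).toLinearMap ∘ₗ g.ofConv.toLinearMap.lTensor M.carrier ∘ₗ
    M.coact

/-- The action of a point `g ∈ G(S)` on `S ⊗ M`. -/
noncomputable def pointAct (g : Points R A S) : S ⊗[R] M.carrier →ₗ[S] S ⊗[R] M.carrier :=
  (M.pointMap g).liftBaseChange S

@[simp]
theorem pointAct_tmul (g : Points R A S) (s : S) (m : M.carrier) :
    M.pointAct g (s ⊗ₜ m) = s • M.pointMap g m :=
  LinearMap.liftBaseChange_tmul ..

theorem pointAct_one (x : S ⊗[R] M.carrier) : M.pointAct 1 x = x := by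
  have h : (TensorProduct.comm R M.carrier S).toLinearMap ∘ₗ
      (1 : Points R A S).ofConv.toLinearMap.lTensor M.carrier =
      TensorProduct.mk R S M.carrier 1 ∘ₗ slice (Coalgebra.counit (R := R) (A := A)) := by
    ext m a
    change algebraMap R S (Coalgebra.counit a) ⊗ₜ[R] m =
      1 ⊗ₜ[R] slice (Coalgebra.counit (R := R) (A := A)) (m ⊗ₜ a)
    rw [slice_tmul, ← TensorProduct.smul_tmul, Algebra.smul_def, mul_one]
  have h1 (m : M.carrier) : M.pointMap (1 : Points R A S) m = 1 ⊗ₜ m := by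
    refine (LinearMap.congr_fun h (M.coact m)).trans ?_
    change 1 ⊗ₜ[R] slice (Coalgebra.counit (R := R) (A := A)) (M.coact m) = _
    rw [M.slice_counit_coact]
  induction x using TensorProduct.induction_on with
  | zero => simp
  | tmul s m => simp [h1, TensorProduct.smul_tmul']
  | add x y hx hy => rw [map_add, hx, hy]

/-- `Side.mul` and `Side.comul` are reversed together, so a single use of coassociativity serves
both sides. -/
theorem pointMap_mul (g h : Points R A S) (m : M.carrier) :
    M.pointMap (σ.mul g h) m = M.pointAct g (M.pointMap h m) := by
  have key : (TensorProduct.comm R M.carrier S).toLinearMap ∘ₗ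
      (LinearMap.mul' R S ∘ₗ TensorProduct.map g.ofConv.toLinearMap
        h.ofConv.toLinearMap).lTensor M.carrier ∘ₗ
        (TensorProduct.assoc R M.carrier A A).toLinearMap ∘ₗ M.coact.rTensor A =
      (M.pointAct g).restrictScalars R ∘ₗ (TensorProduct.comm R M.carrier S).toLinearMap ∘ₗ
        h.ofConv.toLinearMap.lTensor M.carrier := by
    ext m a
    change TensorProduct.comm R M.carrier S ((LinearMap.mul' R S ∘ₗ TensorProduct.map
      g.ofConv.toLinearMap h.ofConv.toLinearMap).lTensor M.carrier
        (TensorProduct.assoc R M.carrier A A (M.coact m ⊗ₜ a))) =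
      M.pointAct g (h.ofConv a ⊗ₜ m)
    rw [pointAct_tmul]
    change _ = h.ofConv a • TensorProduct.comm R M.carrier S
      (g.ofConv.toLinearMap.lTensor M.carrier (M.coact m))
    induction M.coact m using TensorProduct.induction_on with
    | zero => simp
    | tmul m' b => simp [TensorProduct.smul_tmul', mul_comm]
    | add x y hx hy =>
      rw [TensorProduct.add_tmul]
      simp only [map_add, smul_add, hx, hy]
  refine Eq.trans ?_ (LinearMap.congr_fun key (M.coact m))
  change TensorProduct.comm R M.carrier S ((σ.mul g h).ofConv.toLinearMap.lTensor M.carrier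
    (M.coact m)) = TensorProduct.comm R M.carrier S ((LinearMap.mul' R S ∘ₗ TensorProduct.map
      g.ofConv.toLinearMap h.ofConv.toLinearMap).lTensor M.carrier
        (TensorProduct.assoc R M.carrier A A (M.coact.rTensor A (M.coact m))))
  rw [M.assoc_coact, ← LinearMap.lTensor_comp_apply, Side.mul_ofConv_toLinearMap]
  rfl

theorem pointAct_mul (g h : Points R A S) (x : S ⊗[R] M.carrier) :
    M.pointAct (σ.mul g h) x = M.pointAct g (M.pointAct h x) := by
  induction x using TensorProduct.induction_on with
  | zero => simp
  | tmul s m => rw [pointAct_tmul, pointAct_tmul, map_smul, pointMap_mul]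
  | add x y hx hy => simp only [map_add, hx, hy]

theorem map_pointAct (f : S →ₐ[R] T) (g : Points R A S) (x : S ⊗[R] M.carrier) :
    f.toLinearMap.rTensor M.carrier (M.pointAct g x) =
      M.pointAct (Points.map f g) (f.toLinearMap.rTensor M.carrier x) := by
  induction x using TensorProduct.induction_on with
  | zero => simp
  | tmul s m =>
    rw [pointAct_tmul, LinearMap.rTensor_tmul, pointAct_tmul]
    refine ((ModFunctor.quasiCoherent (R := R) M.carrier).map_smul f s _).trans ?_
    change f s • f.toLinearMap.rTensor M.carrier (TensorProduct.comm R M.carrier S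
        (g.ofConv.toLinearMap.lTensor M.carrier (M.coact m))) =
      f s • TensorProduct.comm R M.carrier T
        ((f.toLinearMap ∘ₗ g.ofConv.toLinearMap).lTensor M.carrier (M.coact m))
    congr 1
    induction M.coact m using TensorProduct.induction_on with
    | zero => simp
    | tmul m' b => simp
    | add x y hx hy => simp only [map_add, hx, hy]
  | add x y hx hy => simp only [map_add, hx, hy]

/-- The functor of `G`-modules defined by a rational `G`-module. -/
noncomputable def toGModFunctor : GModFunctor.{u, u + 1} R A σ where
  obj S _ _ := ULift.{u + 1} (S ⊗[R] M.carrier)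
  addCommGroup _ _ _ := inferInstance
  module _ _ _ := inferInstance
  map f :=
    { toFun := fun x => ⟨f.toLinearMap.rTensor M.carrier x.down⟩
      map_zero' := by ext; simp
      map_add' := fun a b => by apply ULift.ext; simp }
  map_smul f s m :=
    congrArg ULift.up ((ModFunctor.quasiCoherent (R := R) M.carrier).map_smul f s m.down)
  map_id m := congrArg ULift.up ((ModFunctor.quasiCoherent (R := R) M.carrier).map_id m.down)
  map_comp g f m :=
    congrArg ULift.up ((ModFunctor.quasiCoherent (R := R) M.carrier).map_comp g f m.down)
  act g := ULift.moduleEquiv.symm.toLinearMap ∘ₗ M.pointAct g ∘ₗ ULift.moduleEquiv.toLinearMap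
  act_one m := congrArg ULift.up (M.pointAct_one m.down)
  act_mul g h m := congrArg ULift.up (M.pointAct_mul g h m.down)
  map_act f g m := congrArg ULift.up (M.map_pointAct f g m.down)

theorem toGModFunctor_isCoherent [Module.Finite R M.carrier] :
    M.toGModFunctor.toModFunctor.IsCoherent :=
  ⟨M.carrier, _, _, inferInstance, ⟨⟨fun S _ _ =>
    (ULift.moduleEquiv : ULift.{u + 1} (S ⊗[R] M.carrier) ≃ₗ[S] S ⊗[R] M.carrier),
    fun _ _ => rfl⟩⟩⟩

theorem mem_invariantsAt_toGModFunctor (m : M.carrier) :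
    (⟨1 ⊗ₜ m⟩ : M.toGModFunctor.obj R) ∈ M.toGModFunctor.invariantsAt R ↔ m ∈ M.invariants := by
  have hmap (T : Type u) [CommRing T] [Algebra R T] (f : R →ₐ[R] T) :
      M.toGModFunctor.map f ⟨1 ⊗ₜ m⟩ = ⟨1 ⊗ₜ m⟩ := by
    apply ULift.ext
    change f 1 ⊗ₜ[R] m = 1 ⊗ₜ[R] m
    rw [map_one]
  have hact (T : Type u) [CommRing T] [Algebra R T] (g : Points R A T) :
      M.toGModFunctor.act g ⟨1 ⊗ₜ m⟩ = ⟨M.pointMap g m⟩ := by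
    apply ULift.ext
    change M.pointAct g (1 ⊗ₜ[R] m) = M.pointMap g m
    rw [pointAct_tmul, one_smul]
  constructor
  · intro h
    -- At the identity point of `G(A)` the action is the coaction itself, up to swapping factors.
    have h1 := h A (Algebra.ofId R A) (toConv (AlgHom.id R A))
    rw [hmap, hact] at h1
    have h2 : TensorProduct.comm R M.carrier A ((LinearMap.id).lTensor M.carrier (M.coact m)) =
      1 ⊗ₜ m := congrArg ULift.down h1
    rw [LinearMap.lTensor_id_apply] at h2
    exact (TensorProduct.comm R M.carrier A).injective h2
  · intro h T _ _ f g
    have h' : M.coact m = m ⊗ₜ[R] (1 : A) := h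
    rw [hmap, hact]
    apply ULift.ext
    change TensorProduct.comm R M.carrier T (g.ofConv.toLinearMap.lTensor M.carrier
      (M.coact m)) = 1 ⊗ₜ m
    rw [h']
    simp

variable {M}

/-- The morphism of functors of `G`-modules defined by a morphism of rational `G`-modules. -/
noncomputable def Hom.toGModFunctor {N : RationalModule R A σ} (φ : M.Hom N) :
    M.toGModFunctor.Hom N.toGModFunctor where
  app S _ _ := ULift.moduleEquiv.symm.toLinearMap ∘ₗ φ.toLinearMap.baseChange S ∘ₗ
    ULift.moduleEquiv.toLinearMap
  naturality {S T} _ _ _ _ f m := by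
    apply ULift.ext
    change φ.toLinearMap.lTensor T (f.toLinearMap.rTensor _ m.down) =
      f.toLinearMap.rTensor _ (φ.toLinearMap.lTensor S m.down)
    rw [← LinearMap.comp_apply, ← LinearMap.comp_apply, LinearMap.lTensor_comp_rTensor,
      LinearMap.rTensor_comp_lTensor]
  map_act {S} _ _ g m := by
    apply ULift.ext
    change φ.toLinearMap.lTensor S (M.pointAct g m.down) =
      N.pointAct g (φ.toLinearMap.lTensor S m.down)
    induction m.down using TensorProduct.induction_on with
    | zero => simp
    | tmul s m =>
      rw [pointAct_tmul, LinearMap.lTensor_tmul, pointAct_tmul]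
      refine ((φ.toLinearMap.baseChange S).map_smul s _).trans ?_
      congr 1
      change φ.toLinearMap.lTensor S (TensorProduct.comm R M.carrier S
          (g.ofConv.toLinearMap.lTensor M.carrier (M.coact m))) =
        TensorProduct.comm R N.carrier S
          (g.ofConv.toLinearMap.lTensor N.carrier (N.coact (φ.toLinearMap m)))
      rw [φ.map_coact]
      induction M.coact m using TensorProduct.induction_on with
      | zero => simp
      | tmul m' b => simp
      | add x y hx hy => simp only [map_add, hx, hy]
    | add x y hx hy => simp only [map_add, hx, hy]

end toGModFunctor

end RationalModule

/-- Tensoring may destroy injectivity of `f`, but the section `s` provides a retraction of `f`, so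
the sequence of functors is exact at every `S`. The lift is then read off at `S = R`. -/
theorem InvariantsExactOn.splitInvariantsLift {R A : Type u} [CommRing R] [CommRing A]
    [Bialgebra R A] {σ : Side} (H : InvariantsExactOn R A σ ModFunctor.IsCoherent) :
    SplitInvariantsLift R A σ := by
  intro M₁ M₂ M₃ f g s _ _ _ hf hfg hs m hm
  have hg : Function.Surjective g.toLinearMap := fun y => ⟨s y, LinearMap.congr_fun hs y⟩
  have hex : ModFunctor.IsShortExact f.toGModFunctor.toHom g.toGModFunctor.toHom := by
    intro S _ _
    refine ⟨?_, ?_, ?_⟩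
    · obtain ⟨r, hr⟩ : ∃ r, r ∘ₗ f.toLinearMap = LinearMap.id :=
        ((hfg.split_tfae'.out 0 1 :
          (Function.Injective f.toLinearMap ∧ ∃ l, g.toLinearMap ∘ₗ l = LinearMap.id) ↔
          (Function.Surjective g.toLinearMap ∧ ∃ l, l ∘ₗ f.toLinearMap = LinearMap.id)).1
            ⟨hf, s, hs⟩).2
      intro x y hxy
      apply ULift.ext
      have h1 : f.toLinearMap.lTensor S x.down = f.toLinearMap.lTensor S y.down :=
        congrArg ULift.down hxy
      have h2 := congrArg (r.lTensor S) h1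
      rwa [← LinearMap.lTensor_comp_apply, ← LinearMap.lTensor_comp_apply, hr,
        LinearMap.lTensor_id_apply, LinearMap.lTensor_id_apply] at h2
    · intro y
      have h := lTensor_exact S hfg hg y.down
      constructor
      · intro hy
        obtain ⟨x, hx⟩ := h.1 (congrArg ULift.down hy)
        exact ⟨ULift.up x, congrArg ULift.up hx⟩
      · rintro ⟨x, rfl⟩
        exact congrArg ULift.up (h.2 ⟨x.down, rfl⟩)
    · intro y
      obtain ⟨x, hx⟩ := LinearMap.lTensor_surjective S hg y.down
      exact ⟨ULift.up x, congrArg ULift.up hx⟩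
  obtain ⟨-, -, h⟩ := H _ _ _ f.toGModFunctor g.toGModFunctor M₁.toGModFunctor_isCoherent
    M₂.toGModFunctor_isCoherent M₃.toGModFunctor_isCoherent hex R
  obtain ⟨y, hy⟩ := h ⟨_, (M₃.mem_invariantsAt_toGModFunctor m).2 hm⟩
  obtain ⟨⟨x⟩, hx⟩ := y
  obtain ⟨m', rfl⟩ := (TensorProduct.lid R M₂.carrier).symm.surjective x
  refine ⟨m', (M₂.mem_invariantsAt_toGModFunctor m').1 hx, ?_⟩
  have h1 : g.toLinearMap.lTensor R (1 ⊗ₜ m') = 1 ⊗ₜ m :=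
    congrArg ULift.down (congrArg Subtype.val hy)
  exact (TensorProduct.lid R M₃.carrier).symm.injective h1

theorem rTensor_lTensor_apply {R M N P Q : Type u} [CommRing R] [AddCommGroup M] [Module R M]
    [AddCommGroup N] [Module R N] [AddCommGroup P] [Module R P] [AddCommGroup Q] [Module R Q]
    (f : M →ₗ[R] N) (g : P →ₗ[R] Q) (x : M ⊗[R] P) :
    f.rTensor Q (g.lTensor M x) = g.lTensor N (f.rTensor P x) := by
  rw [← LinearMap.comp_apply, ← LinearMap.comp_apply, LinearMap.lTensor_comp_rTensor,
    LinearMap.rTensor_comp_lTensor]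

/-! ### Direct sums, trivial, regular and cyclic rational modules -/

namespace RationalModule

variable {R A : Type u} [CommRing R] [CommRing A] [Bialgebra R A] {σ : Side}

/-- Coassociativity is inherited along a linear map compatible with the coactions. -/
theorem assoc_of_map (M : RationalModule R A σ) {P : Type u} [AddCommGroup P] [Module R P]
    (c : P →ₗ[R] P ⊗[R] A) (j : M.carrier →ₗ[R] P) (hj : ∀ m, c (j m) = j.rTensor A (M.coact m))
    (m : M.carrier) :
    TensorProduct.assoc R P A A (c.rTensor A (c (j m))) = (σ.comul R A).lTensor P (c (j m)) := by
  have hc : c ∘ₗ j = j.rTensor A ∘ₗ M.coact := LinearMap.ext hj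
  have h (x : (M.carrier ⊗[R] A) ⊗[R] A) :
      TensorProduct.assoc R P A A ((j.rTensor A).rTensor A x) =
        j.rTensor (A ⊗[R] A) (TensorProduct.assoc R M.carrier A A x) := by
    have : (TensorProduct.assoc R P A A).toLinearMap ∘ₗ (j.rTensor A).rTensor A =
        j.rTensor (A ⊗[R] A) ∘ₗ (TensorProduct.assoc R M.carrier A A).toLinearMap := by
      ext; simp
    exact LinearMap.congr_fun this x
  rw [hj, ← LinearMap.rTensor_comp_apply, hc, LinearMap.rTensor_comp_apply, h, M.assoc_coact,
    rTensor_lTensor_apply]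

theorem slice_counit_of_map (M : RationalModule R A σ) {P : Type u} [AddCommGroup P] [Module R P]
    (c : P →ₗ[R] P ⊗[R] A) (j : M.carrier →ₗ[R] P) (hj : ∀ m, c (j m) = j.rTensor A (M.coact m))
    (m : M.carrier) : slice (Coalgebra.counit (R := R) (A := A)) (c (j m)) = j m := by
  rw [hj, slice_rTensor, M.slice_counit_coact]

/-- The direct sum of two rational modules. -/
noncomputable def prod (M N : RationalModule R A σ) : RationalModule R A σ :=
  let c : M.carrier × N.carrier →ₗ[R] (M.carrier × N.carrier) ⊗[R] A :=
    ((LinearMap.inl R M.carrier N.carrier).rTensor A ∘ₗ M.coact).coprod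
      ((LinearMap.inr R M.carrier N.carrier).rTensor A ∘ₗ N.coact)
  have hl : ∀ m, c (LinearMap.inl R M.carrier N.carrier m) =
      (LinearMap.inl R M.carrier N.carrier).rTensor A (M.coact m) := fun m => by simp [c]
  have hr : ∀ n, c (LinearMap.inr R M.carrier N.carrier n) =
      (LinearMap.inr R M.carrier N.carrier).rTensor A (N.coact n) := fun m => by simp [c]
  { carrier := M.carrier × N.carrier
    coact := c
    coassoc := LinearMap.prod_ext (LinearMap.ext (M.assoc_of_map c _ hl))
      (LinearMap.ext (N.assoc_of_map c _ hr))
    counit_coact := LinearMap.prod_ext (LinearMap.ext (M.slice_counit_of_map c _ hl))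
      (LinearMap.ext (N.slice_counit_of_map c _ hr)) }

/-- The second projection of a direct sum of rational modules. -/
noncomputable def prodSnd (M N : RationalModule R A σ) : (M.prod N).Hom N where
  toLinearMap := LinearMap.snd R M.carrier N.carrier
  map_coact := fun m => by
    change N.coact m.2 = (LinearMap.snd R M.carrier N.carrier).rTensor A
      ((LinearMap.inl R M.carrier N.carrier).rTensor A (M.coact m.1) +
        (LinearMap.inr R M.carrier N.carrier).rTensor A (N.coact m.2))
    rw [map_add, ← LinearMap.rTensor_comp_apply, ← LinearMap.rTensor_comp_apply]
    simp

/-- The first projection of a direct sum of rational modules. -/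
noncomputable def prodFst (M N : RationalModule R A σ) : (M.prod N).Hom M where
  toLinearMap := LinearMap.fst R M.carrier N.carrier
  map_coact := fun m => by
    change M.coact m.1 = (LinearMap.fst R M.carrier N.carrier).rTensor A
      ((LinearMap.inl R M.carrier N.carrier).rTensor A (M.coact m.1) +
        (LinearMap.inr R M.carrier N.carrier).rTensor A (N.coact m.2))
    rw [map_add, ← LinearMap.rTensor_comp_apply, ← LinearMap.rTensor_comp_apply]
    simp

/-- The trivial rational module `R`. -/
noncomputable def trivial (R A : Type u) [CommRing R] [CommRing A] [Bialgebra R A] (σ : Side) :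
    RationalModule R A σ where
  carrier := R
  coact := (TensorProduct.mk R R A).flip 1
  coassoc := by
    ext
    cases σ <;> simp [Side.comul, Bialgebra.comul_one, Algebra.TensorProduct.one_def]
  counit_coact := by ext; simp

/-- The regular rational module `A`. -/
noncomputable def regular (R A : Type u) [CommRing R] [CommRing A] [Bialgebra R A] (σ : Side) :
    RationalModule R A σ where
  carrier := A
  coact := σ.comul R A
  coassoc := by
    cases σ with
    | left => exact Coalgebra.coassoc
    | right =>
      -- `τ` reverses the three factors; it carries the coassociativity of `A` to that of the
      -- opposite comultiplication.
      let τ : A ⊗[R] (A ⊗[R] A) →ₗ[R] A ⊗[R] (A ⊗[R] A) :=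
        (TensorProduct.assoc R A A A).toLinearMap ∘ₗ
          (TensorProduct.comm R A (A ⊗[R] A)).toLinearMap ∘ₗ
            (TensorProduct.comm R A A).toLinearMap.lTensor A
      have h1 : (TensorProduct.assoc R A A A).toLinearMap ∘ₗ
          (Side.right.comul R A).rTensor A ∘ₗ (TensorProduct.comm R A A).toLinearMap =
          τ ∘ₗ (Coalgebra.comul (R := R) (A := A)).lTensor A := by
        ext x y
        simp [τ, Side.comul]
      have h2 : (Side.right.comul R A).lTensor A ∘ₗ (TensorProduct.comm R A A).toLinearMap =
          τ ∘ₗ (TensorProduct.assoc R A A A).toLinearMap ∘ₗ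
            (Coalgebra.comul (R := R) (A := A)).rTensor A := by
        ext x y
        change y ⊗ₜ[R] TensorProduct.comm R A A (Coalgebra.comul x) =
          τ (TensorProduct.assoc R A A A (Coalgebra.comul x ⊗ₜ[R] y))
        induction (Coalgebra.comul x : A ⊗[R] A) using TensorProduct.induction_on with
        | zero => simp
        | tmul a b => simp [τ]
        | add a b ha hb =>
          rw [TensorProduct.add_tmul]
          simp only [map_add, TensorProduct.tmul_add, ha, hb]
      ext a
      refine (LinearMap.congr_fun h1 (Coalgebra.comul a)).trans
        (Eq.trans ?_ (LinearMap.congr_fun h2 (Coalgebra.comul a)).symm)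
      exact congrArg τ (Coalgebra.coassoc_apply a).symm
  counit_coact := by
    cases σ with
    | left =>
      ext a
      change TensorProduct.rid R A (Coalgebra.counit.lTensor A (Coalgebra.comul a)) = a
      rw [Coalgebra.lTensor_counit_comul]
      simp
    | right =>
      ext a
      change TensorProduct.rid R A (Coalgebra.counit.lTensor A
        (TensorProduct.comm R A A (Coalgebra.comul a))) = a
      have h : Coalgebra.counit.lTensor A (TensorProduct.comm R A A (Coalgebra.comul a)) =
          TensorProduct.comm R R A (Coalgebra.counit.rTensor A (Coalgebra.comul a)) := by
        induction (Coalgebra.comul a : A ⊗[R] A) using TensorProduct.induction_on with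
        | zero => simp
        | tmul a b => simp
        | add a b ha hb => simp only [map_add, ha, hb]
      rw [h, Coalgebra.rTensor_counit_comul]
      simp

/-- The submodule of the `u • b`, `u` a linear form on `A`. -/
noncomputable def cyclic (M : RationalModule R A σ) (b : M.carrier) : Submodule R M.carrier :=
  LinearMap.range ((TensorProduct.rid R M.carrier).toLinearMap ∘ₗ
    (LinearMap.lTensorHom (R := R) (N := A) (P := R) M.carrier).flip (M.coact b))

theorem mem_cyclic {M : RationalModule R A σ} {b m : M.carrier} :
    m ∈ M.cyclic b ↔ ∃ u : A →ₗ[R] R, M.formAct u b = m := Iff.rfl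

theorem formAct_mem_cyclic (M : RationalModule R A σ) (b : M.carrier) (u : A →ₗ[R] R)
    (m : M.carrier) (hm : m ∈ M.cyclic b) : M.formAct u m ∈ M.cyclic b := by
  obtain ⟨v, rfl⟩ := mem_cyclic.1 hm
  exact mem_cyclic.2 ⟨_, (M.formAct_formAct v u b).symm⟩

end RationalModule

/-! ### Left and right translations of `A` -/

/-- The translate `a ↦ u • a` on the regular module `A` by a linear form `u`. -/
noncomputable def Side.translate {R A : Type u} [CommRing R] [CommRing A] [Bialgebra R A]
    (σ : Side) (u : A →ₗ[R] R) : A →ₗ[R] A :=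
  slice u ∘ₗ σ.comul R A

section translate

variable {R A : Type u} [CommRing R] [CommRing A] [Bialgebra R A]

theorem Side.translate_algebraMap (σ : Side) (u : A →ₗ[R] R) (r : R) :
    σ.translate u (algebraMap R A r) = algebraMap R A (u 1 * r) := by
  have h : σ.comul R A 1 = 1 ⊗ₜ 1 := by
    cases σ <;> simp [Side.comul, Bialgebra.comul_one, Algebra.TensorProduct.one_def]
  rw [Algebra.algebraMap_eq_smul_one, map_smul, Side.translate, LinearMap.comp_apply, h,
    slice_tmul, smul_smul, mul_comm, Algebra.algebraMap_eq_smul_one]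

theorem Side.translate_one (σ : Side) (u : A →ₗ[R] R) :
    σ.translate u (1 : A) = algebraMap R A (u 1) := by
  simpa only [map_one, mul_one] using σ.translate_algebraMap u 1

theorem Side.translate_translate (σ : Side) (u v : A →ₗ[R] R) (a : A) :
    σ.translate v (σ.translate u a) = σ.translate (v ∘ₗ σ.translate u) a :=
  (RationalModule.regular R A σ).formAct_formAct u v a

/-- The actions of linear forms on `A` by left and right translations commute. -/
theorem translate_right_translate_left (u v : A →ₗ[R] R) (a : A) :
    Side.right.translate v (Side.left.translate u a) =
      Side.left.translate u (Side.right.translate v a) := by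
  let φ : A →ₗ[R] A := Side.right.translate v
  let s : A ⊗[R] (A ⊗[R] A) →ₗ[R] A ⊗[R] A :=
    (TensorProduct.lid R (A ⊗[R] A)).toLinearMap ∘ₗ v.rTensor (A ⊗[R] A)
  have h1 : (Coalgebra.comul (R := R) (A := A)) ∘ₗ slice v ∘ₗ
      (TensorProduct.comm R A A).toLinearMap =
      s ∘ₗ (Coalgebra.comul (R := R) (A := A)).lTensor A := by
    ext x y
    simp [s]
  have h2 : φ.rTensor A = s ∘ₗ (TensorProduct.assoc R A A A).toLinearMap ∘ₗ
      (Coalgebra.comul (R := R) (A := A)).rTensor A := by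
    ext x y
    change slice v (TensorProduct.comm R A A (Coalgebra.comul x)) ⊗ₜ[R] y =
      s (TensorProduct.assoc R A A A (Coalgebra.comul x ⊗ₜ[R] y))
    induction (Coalgebra.comul x : A ⊗[R] A) using TensorProduct.induction_on with
    | zero => simp
    | tmul a b => simp [s, TensorProduct.smul_tmul']
    | add a b ha hb =>
      rw [TensorProduct.add_tmul]
      simp only [map_add, TensorProduct.add_tmul, ha, hb]
  -- By coassociativity a right translation is an endomorphism of the left regular module, and
  -- morphisms commute with the action of forms.
  let f : (RationalModule.regular R A .left).Hom (RationalModule.regular R A .left) :=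
    { toLinearMap := φ
      map_coact := fun (a : A) => by
        refine (LinearMap.congr_fun h1 (Coalgebra.comul a)).trans
          (Eq.trans ?_ (LinearMap.congr_fun h2 (Coalgebra.comul a)).symm)
        exact congrArg s (Coalgebra.coassoc_apply a).symm }
  exact f.map_formAct u a

end translate

/-! ### Dual bases, stable submodules and finiteness -/

section Projective

variable {R A : Type u} [CommRing R] [CommRing A] [Algebra R A] [Module.Projective R A]

/-- A dual basis expansion of the elements of `M ⊗ A`, for `A` projective. -/
theorem exists_sum_slice_tmul {M : Type u} [AddCommGroup M] [Module R M] (x : M ⊗[R] A) :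
    ∃ (s : Finset A) (u : A → A →ₗ[R] R), x = ∑ j ∈ s, slice (u j) x ⊗ₜ[R] j := by
  obtain ⟨i, hi⟩ := Module.projective_def'.1 (inferInstance : Module.Projective R A)
  let u (j : A) : A →ₗ[R] R := Finsupp.lapply j ∘ₗ i
  -- Allowing every larger index set makes the statement additive in `x`: two summands can share the
  -- union of their sets.
  suffices h : ∃ s : Finset A, ∀ t, s ⊆ t → x = ∑ j ∈ t, slice (u j) x ⊗ₜ[R] j by
    obtain ⟨s, hs⟩ := h
    exact ⟨s, u, hs s subset_rfl⟩
  classical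
  induction x using TensorProduct.induction_on with
  | zero => exact ⟨∅, by simp⟩
  | tmul m a =>
    refine ⟨(i a).support, fun t ht => ?_⟩
    have h : a = ∑ j ∈ t, i a j • j := by
      refine (LinearMap.congr_fun hi a).symm.trans ?_
      exact Finsupp.sum_of_support_subset _ ht _ (by simp)
    simp only [slice_tmul, TensorProduct.smul_tmul, ← TensorProduct.tmul_sum]
    exact congrArg (m ⊗ₜ[R] ·) h
  | add x y hx hy =>
    obtain ⟨s, hs⟩ := hx
    obtain ⟨s', hs'⟩ := hy
    refine ⟨s ∪ s', fun t ht => ?_⟩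
    simp only [map_add, TensorProduct.add_tmul, Finset.sum_add_distrib]
    rw [← hs t (Finset.union_subset_left ht), ← hs' t (Finset.union_subset_right ht)]

end Projective

namespace RationalModule

variable {R A : Type u} [CommRing R] [CommRing A] [Bialgebra R A] [Module.Projective R A]
  {σ : Side}

section sub

variable (M : RationalModule R A σ) (N : Submodule R M.carrier)
  (hN : ∀ (u : A →ₗ[R] R), ∀ m ∈ N, M.formAct u m ∈ N)

theorem rTensor_subtype_injective : Function.Injective (N.subtype.rTensor A) :=
  Module.Flat.rTensor_preserves_injective_linearMap _ N.injective_subtype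

/-- In the dual basis expansion of `μ n` the coefficients are the elements `u j • n`, which lie in
`N` by stability. -/
theorem coact_mem_range
    (hN : ∀ (u : A →ₗ[R] R), ∀ m ∈ N, M.formAct u m ∈ N) (n : N) :
    M.coact n ∈ LinearMap.range (N.subtype.rTensor A) := by
  obtain ⟨s, u, h⟩ := exists_sum_slice_tmul (M.coact n)
  rw [h]
  exact Submodule.sum_mem _ fun j _ => ⟨⟨_, hN (u j) n n.2⟩ ⊗ₜ j, rfl⟩

/-- The coaction on a submodule which is stable under the action of the linear forms on `A`. -/
noncomputable def subCoact : N →ₗ[R] N ⊗[R] A :=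
  (LinearEquiv.ofInjective _ (M.rTensor_subtype_injective N)).symm.toLinearMap ∘ₗ
    (M.coact ∘ₗ N.subtype).codRestrict _ (M.coact_mem_range N hN)

theorem rTensor_subCoact (n : N) : N.subtype.rTensor A (M.subCoact N hN n) = M.coact n :=
  congrArg Subtype.val ((LinearEquiv.ofInjective _ (M.rTensor_subtype_injective N)).apply_symm_apply
    ((M.coact ∘ₗ N.subtype).codRestrict _ (M.coact_mem_range N hN) n))

/-- The rational module structure on a submodule which is stable under the action of the linear
forms on `A`. -/
noncomputable def sub : RationalModule R A σ where
  carrier := N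
  coact := M.subCoact N hN
  coassoc := by
    ext n
    apply Module.Flat.rTensor_preserves_injective_linearMap (M := A ⊗[R] A) N.subtype
      N.injective_subtype
    have h1 (y : N ⊗[R] A) : N.subtype.rTensor (A ⊗[R] A)
        (TensorProduct.assoc R N A A ((M.subCoact N hN).rTensor A y)) =
        TensorProduct.assoc R M.carrier A A (M.coact.rTensor A (N.subtype.rTensor A y)) := by
      have h2 (z : (N ⊗[R] A) ⊗[R] A) : N.subtype.rTensor (A ⊗[R] A)
          (TensorProduct.assoc R N A A z) =
          TensorProduct.assoc R M.carrier A A ((N.subtype.rTensor A).rTensor A z) := by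
        have : N.subtype.rTensor (A ⊗[R] A) ∘ₗ (TensorProduct.assoc R N A A).toLinearMap =
            (TensorProduct.assoc R M.carrier A A).toLinearMap ∘ₗ
              (N.subtype.rTensor A).rTensor A := by
          ext; simp
        exact LinearMap.congr_fun this z
      have h3 : N.subtype.rTensor A ∘ₗ M.subCoact N hN = M.coact ∘ₗ N.subtype :=
        LinearMap.ext (M.rTensor_subCoact N hN)
      rw [h2, ← LinearMap.rTensor_comp_apply, h3, LinearMap.rTensor_comp_apply]
    change N.subtype.rTensor (A ⊗[R] A) (TensorProduct.assoc R N A A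
        ((M.subCoact N hN).rTensor A (M.subCoact N hN n))) =
      N.subtype.rTensor (A ⊗[R] A) ((σ.comul R A).lTensor N (M.subCoact N hN n))
    rw [h1, rTensor_subCoact, assoc_coact, ← rTensor_subCoact M N hN, rTensor_lTensor_apply]
  counit_coact := by
    ext n
    change N.subtype (slice Coalgebra.counit (M.subCoact N hN n)) = n
    rw [← slice_rTensor, rTensor_subCoact, slice_counit_coact]

theorem mem_invariants_sub (n : N) :
    n ∈ (M.sub N hN).invariants ↔ (n : M.carrier) ∈ M.invariants := by
  change M.subCoact N hN n = n ⊗ₜ 1 ↔ M.coact n = (n : M.carrier) ⊗ₜ 1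
  rw [← (M.rTensor_subtype_injective N).eq_iff, rTensor_subCoact]
  rfl

/-- The restriction of a morphism to a stable submodule. -/
noncomputable def Hom.domRestrict {M P : RationalModule R A σ} (p : M.Hom P)
    (N : Submodule R M.carrier) (hN : ∀ (u : A →ₗ[R] R), ∀ m ∈ N, M.formAct u m ∈ N) :
    (M.sub N hN).Hom P where
  toLinearMap := p.toLinearMap ∘ₗ N.subtype
  map_coact := fun (n : N) => by
    change P.coact (p.toLinearMap n.1) =
      (p.toLinearMap ∘ₗ N.subtype).rTensor A (M.subCoact N hN n)
    rw [LinearMap.rTensor_comp_apply, rTensor_subCoact, p.map_coact]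

/-- The inclusion of a stable submodule in a larger one. -/
noncomputable def subInclusion {N N' : Submodule R M.carrier}
    (hN : ∀ (u : A →ₗ[R] R), ∀ m ∈ N, M.formAct u m ∈ N)
    (hN' : ∀ (u : A →ₗ[R] R), ∀ m ∈ N', M.formAct u m ∈ N') (h : N ≤ N') :
    (M.sub N hN).Hom (M.sub N' hN') where
  toLinearMap := Submodule.inclusion h
  map_coact := fun n => by
    apply M.rTensor_subtype_injective N'
    change N'.subtype.rTensor A (M.subCoact N' hN' (Submodule.inclusion h n)) =
      N'.subtype.rTensor A ((Submodule.inclusion h).rTensor A (M.subCoact N hN n))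
    rw [rTensor_subCoact, ← LinearMap.rTensor_comp_apply]
    exact (M.rTensor_subCoact N hN n).symm

end sub

/-- The finite expansion `μ b = ∑ (u j • b) ⊗ j` gives `v • b = ∑ v j • (u j • b)` for every form
`v`. -/
theorem cyclic_fg (M : RationalModule R A σ) (b : M.carrier) : (M.cyclic b).FG := by
  classical
  obtain ⟨s, u, h⟩ := exists_sum_slice_tmul (M.coact b)
  refine ⟨s.image fun j => M.formAct (u j) b, le_antisymm (Submodule.span_le.2 ?_) ?_⟩
  · intro m hm
    obtain ⟨j, -, rfl⟩ := Finset.mem_image.1 hm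
    exact mem_cyclic.2 ⟨u j, rfl⟩
  · intro m hm
    obtain ⟨v, rfl⟩ := mem_cyclic.1 hm
    change slice v (M.coact b) ∈ _
    rw [h, map_sum]
    refine Submodule.sum_mem _ fun j hj => ?_
    rw [slice_tmul]
    exact Submodule.smul_mem _ _ (Submodule.subset_span (Finset.mem_image_of_mem _ hj))

/-- If `p : M → R` is equivariant and `p b = 1` then there is an invariant element `u • b` with
`u 1 = 1`. -/
theorem exists_formAct_mem_invariants (H : SplitInvariantsLift R A σ) (M : RationalModule R A σ)
    (p : M.Hom (trivial R A σ)) (b : M.carrier) (hb : p.toLinearMap b = (1 : R)) :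
    ∃ u : A →ₗ[R] R, u 1 = 1 ∧ M.formAct u b ∈ M.invariants := by
  let B := M.cyclic b
  let q : M.carrier →ₗ[R] R := p.toLinearMap
  have hq (u : A →ₗ[R] R) (m : M.carrier) : q (M.formAct u m) = u 1 * q m := by
    refine (p.map_formAct u m).trans ?_
    exact slice_tmul u (q m) 1
  let K := B ⊓ LinearMap.ker q
  have hB := M.formAct_mem_cyclic b
  have hK (u : A →ₗ[R] R) (m : M.carrier) (hm : m ∈ K) : M.formAct u m ∈ K := by
    refine ⟨hB u m hm.1, ?_⟩
    have h0 : q m = 0 := hm.2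
    change q (M.formAct u m) = 0
    rw [hq, h0, mul_zero]
  have hbB : b ∈ B := mem_cyclic.2 ⟨Coalgebra.counit, M.slice_counit_coact b⟩
  have hKfg : K.FG := by
    -- Since `q b = 1`, the map `m ↦ m - q m • b` projects `B` onto `K`, so `K` inherits finite
    -- generation.
    have hKB : K = B.map (LinearMap.id - q.smulRight b) := by
      ext m
      constructor
      · rintro ⟨h1, h2⟩
        have h0 : q m = 0 := h2
        exact ⟨m, h1, by simp [h0]⟩
      · rintro ⟨m, hm, rfl⟩
        refine ⟨B.sub_mem hm (B.smul_mem _ hbB), ?_⟩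
        have hb' : q b = 1 := hb
        simp [hb']
    rw [hKB]
    exact (M.cyclic_fg b).map _
  -- The sequence `0 → K → B → R → 0` is split by `1 ↦ b`; the invariant `1` of `R` is lifted to
  -- `B`.
  obtain ⟨m, hm, hm1⟩ := H (M.sub K hK) (M.sub B hB) (trivial R A σ)
    (M.subInclusion hK hB (inf_le_left : K ≤ B)) (p.domRestrict B hB)
    (LinearMap.toSpanSingleton R B ⟨b, hbB⟩) (Module.Finite.iff_fg.2 hKfg)
    (Module.Finite.iff_fg.2 (M.cyclic_fg b)) (Module.Finite.self R)
    (Submodule.inclusion_injective (inf_le_left : K ≤ B))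
    (fun x => ⟨fun hx => ⟨⟨x.1, x.2, hx⟩, rfl⟩, by rintro ⟨y, rfl⟩; exact y.2.2⟩)
    (LinearMap.ext_ring (by
      change q ((1 : R) • b) = 1
      rw [one_smul]
      exact hb))
    (1 : R) (by change (1 : R) ⊗ₜ[R] (1 : A) = (1 : R) ⊗ₜ[R] (1 : A); rfl)
  obtain ⟨u, hu⟩ := mem_cyclic.1 m.2
  refine ⟨u, ?_, ?_⟩
  · have h1 : q m.1 = 1 := hm1
    have hb' : q b = 1 := hb
    rw [← hu, hq, hb', mul_one] at h1
    exact h1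
  · rw [hu]
    exact (M.mem_invariants_sub B hB m).1 hm

/-- Invariant functions are constant: apply the counit to the factor of `Δ a` that contains `a`. -/
theorem mem_invariants_regular {R A : Type u} [CommRing R] [CommRing A] [Bialgebra R A]
    {σ : Side} {a : A} (ha : a ∈ (regular R A σ).invariants) :
    a = algebraMap R A (Coalgebra.counit a) := by
  have h1 : σ.comul R A a = a ⊗ₜ 1 := ha
  cases σ with
  | left =>
    have h2 := Coalgebra.rTensor_counit_comul (R := R) a
    have h1 : Coalgebra.comul a = a ⊗ₜ[R] (1 : A) := h1
    rw [h1] at h2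
    simpa [Algebra.smul_def] using (congrArg (TensorProduct.lid R A) h2).symm
  | right =>
    have h2 := Coalgebra.lTensor_counit_comul (R := R) a
    have h1 : Coalgebra.comul a = (1 : A) ⊗ₜ[R] a :=
      (TensorProduct.comm R A A).injective h1
    rw [h1] at h2
    simpa [Algebra.smul_def] using (congrArg (TensorProduct.rid R A) h2).symm

/-- Applied to `b = (a, 1)` in `A ⊕ R`: the second coordinate forces `u 1 = 1`, and the first makes
`u • a` an invariant of the regular module, hence a scalar. -/
theorem exists_translate_eq (H : SplitInvariantsLift R A σ) (a : A) :
    ∃ (r : R) (u : A →ₗ[R] R), u 1 = 1 ∧ σ.translate u a = algebraMap R A r := by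
  obtain ⟨u, hu, h⟩ := exists_formAct_mem_invariants H _
    (prodSnd (regular R A σ) (trivial R A σ)) ((a, 1) : A × R) rfl
  let p := prodFst (regular R A σ) (trivial R A σ)
  have h1 : p.toLinearMap (((regular R A σ).prod (trivial R A σ)).formAct u ((a, 1) : A × R)) =
      σ.translate u a := p.map_formAct u ((a, 1) : A × R)
  have h2 : p.toLinearMap (((regular R A σ).prod (trivial R A σ)).formAct u ((a, 1) : A × R)) ∈
      (regular R A σ).invariants := (p.invariants ⟨_, h⟩).2
  exact ⟨_, u, hu, mem_invariants_regular (h1 ▸ h2)⟩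

end RationalModule

/-! ### Construction of the Reynolds form -/

section Reynolds

variable {R A : Type u} [CommRing R] [CommRing A] [Bialgebra R A]

/-- Some linear form `u` with `u 1 = 1` moves `a` to the scalar `r`. -/
def IsMean (σ : Side) (a : A) (r : R) : Prop :=
  ∃ u : A →ₗ[R] R, u 1 = 1 ∧ σ.translate u a = algebraMap R A r

/-- Translating `a` on both sides by `u` and `v` gives `r` or `r'` according to the order, and the
two translations commute. The counit then recovers the scalars. -/
theorem IsMean.eq {a : A} {r r' : R} (h : IsMean .left a r) (h' : IsMean .right a r') :
    r = r' := by
  obtain ⟨u, hu, h⟩ := h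
  obtain ⟨v, hv, h'⟩ := h'
  have h1 := translate_right_translate_left u v a
  rw [h, h', Side.translate_algebraMap, Side.translate_algebraMap, hu, hv, one_mul, one_mul] at h1
  simpa using congrArg (Coalgebra.counit (R := R)) h1

theorem IsMean.smul {σ : Side} {a : A} {r : R} (h : IsMean σ a r) (c : R) :
    IsMean σ (c • a) (c * r) := by
  obtain ⟨u, hu, h⟩ := h
  exact ⟨u, hu, by rw [map_smul, h, map_mul, Algebra.smul_def]⟩

theorem IsMean.one (σ : Side) : IsMean σ (1 : A) (1 : R) :=
  ⟨Coalgebra.counit, Bialgebra.counit_one, by rw [Side.translate_one, Bialgebra.counit_one]⟩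

/-- A common form for both elements: after `u` has made `a` constant, choose `v` making `u • a'`
constant. Then `v` fixes the constant `r`, as `v 1 = 1`, and the composite form serves `a`, `a'` and
hence `a + a'`. -/
theorem IsMean.exists_add {σ : Side} (H : ∀ a : A, ∃ r : R, IsMean σ a r) {a a' : A} {r : R}
    (h : IsMean σ a r) : ∃ r', IsMean σ a' r' ∧ IsMean σ (a + a') (r + r') := by
  obtain ⟨u, hu, h⟩ := h
  obtain ⟨r', v, hv, h'⟩ := H (σ.translate u a')
  rw [Side.translate_translate] at h'
  have h1 : (v ∘ₗ σ.translate u) 1 = 1 := by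
    rw [LinearMap.comp_apply, Side.translate_one, hu, map_one, hv]
  refine ⟨r', ⟨_, h1, h'⟩, _, h1, ?_⟩
  rw [map_add, h', ← Side.translate_translate, h, Side.translate_algebraMap, hv, one_mul, map_add]

theorem IsMean.translate_right {a : A} {r : R} (h : IsMean .left a r) (v : A →ₗ[R] R) :
    IsMean .left (Side.right.translate v a) (v 1 * r) := by
  obtain ⟨u, hu, h⟩ := h
  exact ⟨u, hu, by rw [← translate_right_translate_left, h, Side.translate_algebraMap]⟩

theorem IsMean.translate_left {a : A} {r : R} (h : IsMean .right a r) (v : A →ₗ[R] R) :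
    IsMean .right (Side.left.translate v a) (v 1 * r) := by
  obtain ⟨u, hu, h⟩ := h
  exact ⟨u, hu, by rw [translate_right_translate_left, h, Side.translate_algebraMap]⟩

/-- The mean is chosen element by element; linearity and invariance both follow from `IsMean.eq`,
since two expressions that are means of the same element on opposite sides must agree. -/
theorem exists_isReynolds [Module.Projective R A] (hl : SplitInvariantsLift R A .left)
    (hr : SplitInvariantsLift R A .right) : ∃ w : A →ₗ[R] R, IsReynolds w := by
  have Hl (a : A) : ∃ r : R, IsMean .left a r := RationalModule.exists_translate_eq hl a
  have Hr (a : A) : ∃ r : R, IsMean .right a r := RationalModule.exists_translate_eq hr a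
  choose w hw using Hl
  have hw' (a : A) : IsMean .right a (w a) := by
    obtain ⟨r, h⟩ := Hr a
    rwa [(hw a).eq h]
  let W : A →ₗ[R] R :=
    { toFun := w
      map_add' := fun a a' => by
        obtain ⟨r', h1, h2⟩ := (hw a).exists_add (fun a => ⟨w a, hw a⟩) (a' := a')
        rw [← h1.eq (hw' a'), h2.eq (hw' _)]
      map_smul' := fun c a => ((hw a).smul c).eq (hw' _) |>.symm }
  -- Interchanging the two contractions turns the invariance of `W`, tested against `u`, into the
  -- computation of the mean of a translate on the opposite side.
  have hswap (u : A →ₗ[R] R) (x : A ⊗[R] A) :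
      u (slice W x) = W (slice u (TensorProduct.comm R A A x)) := by
    induction x using TensorProduct.induction_on with
    | zero => simp
    | tmul a b => simp [mul_comm]
    | add x y hx hy => simp only [map_add, hx, hy]
  -- Linear forms separate the elements of a projective module.
  have hsep (x y : A) (h : ∀ u : A →ₗ[R] R, u x = u y) : x = y := by
    rw [← sub_eq_zero, ← Module.forall_dual_apply_eq_zero_iff R]
    intro u
    rw [map_sub, h, sub_self]
  refine ⟨W, (IsMean.one .left).eq (hw' 1) |>.symm, fun σ a => hsep _ _ fun u => ?_⟩
  change u (slice W (σ.comul R A a)) = u (W a • 1)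
  rw [hswap, map_smul, smul_eq_mul, mul_comm]
  cases σ with
  | left => exact ((hw a).translate_right u).eq (hw' _) |>.symm
  | right =>
    have h1 : TensorProduct.comm R A A (Side.right.comul R A a) = Side.left.comul R A a :=
      (TensorProduct.comm R A A).symm_apply_apply _
    rw [h1]
    exact (hw _).eq ((hw' a).translate_left u)

end Reynolds

theorem mainTheorem8 (R A : Type u) [CommRing R] [CommRing A] [Bialgebra R A]
    [Module.Projective R A] :
    List.TFAE [
      -- `G = Spec A` is invariant exact
      IsInvariantExact R A,
      -- taking invariants is exact on (left and right) coherent `G`-modules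
      InvariantsExactOn R A .left ModFunctor.IsCoherent ∧
        InvariantsExactOn R A .right ModFunctor.IsCoherent,
      -- taking invariants is exact on (left and right) quasi-coherent `G`-modules
      InvariantsExactOn R A .left ModFunctor.IsQuasiCoherent ∧
        InvariantsExactOn R A .right ModFunctor.IsQuasiCoherent,
      -- taking invariants is exact on (left and right) rational `G`-modules that are
      -- finitely generated over `R`
      RationalInvariantsExactOn R A .left (fun M => Module.Finite R M.carrier) ∧
        RationalInvariantsExactOn R A .right (fun M => Module.Finite R M.carrier),
      -- taking invariants is exact on (left and right) rational `G`-modules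
      RationalInvariantsExactOn R A .left (fun _ => True) ∧
        RationalInvariantsExactOn R A .right (fun _ => True)] := by
  tfae_have 1 → 3 := fun h =>
    ⟨fun M₁ M₂ M₃ f g h₁ h₂ h₃ => h.1 M₁ M₂ M₃ f g h₁.isDual h₂.isDual h₃.isDual,
      fun M₁ M₂ M₃ f g h₁ h₂ h₃ => h.2 M₁ M₂ M₃ f g h₁.isDual h₂.isDual h₃.isDual⟩
  tfae_have 3 → 2 := fun h =>
    ⟨fun M₁ M₂ M₃ f g h₁ h₂ h₃ => h.1 M₁ M₂ M₃ f g h₁.isQuasiCoherent h₂.isQuasiCoherent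
        h₃.isQuasiCoherent,
      fun M₁ M₂ M₃ f g h₁ h₂ h₃ => h.2 M₁ M₂ M₃ f g h₁.isQuasiCoherent h₂.isQuasiCoherent
        h₃.isQuasiCoherent⟩
  tfae_have 2 → 5 := fun h => by
    obtain ⟨w, hw⟩ := exists_isReynolds h.1.splitInvariantsLift h.2.splitInvariantsLift
    exact ⟨hw.rationalInvariantsExactOn .left, hw.rationalInvariantsExactOn .right⟩
  tfae_have 5 → 4 := fun h =>
    ⟨fun M₁ M₂ M₃ f g _ _ _ => h.1 M₁ M₂ M₃ f g trivial trivial trivial,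
      fun M₁ M₂ M₃ f g _ _ _ => h.2 M₁ M₂ M₃ f g trivial trivial trivial⟩
  tfae_have 4 → 1 := fun h => by
    obtain ⟨w, hw⟩ := exists_isReynolds h.1.splitInvariantsLift h.2.splitInvariantsLift
    exact ⟨hw.invariantsExactOn_isDual .left, hw.invariantsExactOn_isDual .right⟩
  tfae_finish
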